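/- Let $n,K\ge 1$ be integers, let $X$ be a random variable on the finite alphabet $\{x_1,\dots,x_n\}$ with unknown distribution $P_X=(p_1,\dots,p_n)$, $p_j>0$ for all $j$, and let $g_1,\dots,g_K:\{x_1,\dots,x_n\}\to\mathbb R$ be functions ("arms"). Let $z_{k,1},\dots,z_{k,m_k}$ be the distinct values of $g_k$, let $A_k\in\{0,1\}^{m_k\times n}$ be given by $A_k(i,j)=1$ iff $g_k(x_j)=z_{k,i}$, and let $A=[A_1^{\mathsf T},\dots,A_K^{\mathsf T}]^{\mathsf T}$. Arm $r$ is called redundant if the row space of $A_r$ is strictly contained in the row space of $A_s$ for some arm $s$. Let $X_1,X_2,\dots$ be i.i.d. copies of $X$. The algorithm UBpull+MLest works as follows. (Elimination.) Remove all redundant arms, and of several non-redundant arms with the same row space keep exactly one, chosen by a possibly random rule. Let $R$ be the set of remaining arms, and let $\bar A$ be the matrix obtained by stacking the $A_k$, $k\in R$; index its rows by pairs $(k,i)$, and let $\bar A^+$ be its Moore-Penrose inverse. (Iteration.) Let $t_k$ be the number of pulls of arm $k\in R$ so far and $t_{k,i}$ the number of times that $z_{k,i}$ has been observed from arm $k$,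 all initially $0$, write $\mathbf t=(t_k)_{k\in R}$, and let $\tilde P(0)=(1/n,\dots,1/n)$. For a distribution $P$ write $q_{k,i}(P)=\sum_j A_k(i,j)P_j$, and let $$U(P,\mathbf t)=\sum_{j=1}^n\sum_{k\in R}\sum_{i=1}^{m_k}\bigl(\bar A^+(j,(k,i))\bigr)^2\,\frac{q_{k,i}(P)\,(1-q_{k,i}(P))}{t_k}.$$ At step $t+1$, pull an arm $c_{t+1}\in R$ that maximizes the decrease $U(\tilde P(t),\mathbf t)-U(\tilde P(t),\mathbf t+\mathbf e^{(k)})$ over $k\in R$, where $\mathbf e^{(k)}$ is the $k$-th unit vector and the decrease is $+\infty$ for every arm $k$ with $t_k=0$. Observe $g_{c_{t+1}}(X_{t+1})$, update the counts, and let $\tilde P(t+1)$ be the distribution $P$ that maximizes the smoothed log-likelihood $$\sum_{k\in R}\sum_{i=1}^{m_k}(t_{k,i}+1)\log q_{k,i}(P)$$ over all probability distributions $P$ on the alphabet. Ties between maximizing arms are broken by random priority orders on the arms. These orders, and the random choices in the elimination, are independent of the sequence $(X_t)$ and otherwise have an arbitrary joint law (for example, all ties are broken uniformly at random). Theorem.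 If $\operatorname{rank}(A)=n$, then the algorithm is asymptotically consistent: almost surely, every remaining arm $k\in R$ (one representative of each class of non-redundant arms with equal row spaces) is pulled infinitely often, that is, $t_k\to\infty$ as $t\to\infty$; and the mean squared error of the estimate vanishes, $$\varepsilon(t)=\mathbb E\Bigl[\sum_{j=1}^n(\tilde p_j(t)-p_j)^2\Bigr]\longrightarrow 0\qquad(t\to\infty).$$ -/

import Mathlib

open MeasureTheory ProbabilityTheory Filter Topology
open scoped BigOperators

noncomputable section

namespace ArmSampling

/-! ### The Moore-Penrose inverse of a real matrix -/

section PseudoInverse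

variable {m n : Type*} [Fintype m] [Fintype n]

/-- The four Penrose equations: `B` is the Moore-Penrose inverse of `A`. -/
structure IsMoorePenrose (A : Matrix m n ℝ) (B : Matrix n m ℝ) : Prop where
  mul_mul_self : A * B * A = A
  mul_mul_inv : B * A * B = B
  symm_left : (A * B).transpose = A * B
  symm_right : (B * A).transpose = B * A

theorem IsMoorePenrose.unique {A : Matrix m n ℝ} {B C : Matrix n m ℝ}
    (hB : IsMoorePenrose A B) (hC : IsMoorePenrose A C) : B = C := by
  have h1 : A * B = A * C := by
    calc A * B = (A * B).transpose := hB.symm_left.symm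
      _ = (A * C * (A * B)).transpose := by
          rw [← Matrix.mul_assoc, hC.mul_mul_self]
      _ = (A * B) * (A * C) := by
          rw [Matrix.transpose_mul, hB.symm_left, hC.symm_left]
      _ = A * C := by rw [← Matrix.mul_assoc, hB.mul_mul_self]
  have h2 : B * A = C * A := by
    calc B * A = (B * A).transpose := hB.symm_right.symm
      _ = (B * A * (C * A)).transpose := by
          rw [Matrix.mul_assoc, ← Matrix.mul_assoc A, hC.mul_mul_self]
      _ = (C * A) * (B * A) := by
          rw [Matrix.transpose_mul, hB.symm_right, hC.symm_right]
      _ = C * A := by rw [Matrix.mul_assoc, ← Matrix.mul_assoc A, hB.mul_mul_self]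
  calc B = B * A * B := hB.mul_mul_inv.symm
    _ = C * A * C := by rw [h2, Matrix.mul_assoc, h1, ← Matrix.mul_assoc]
    _ = C := hC.mul_mul_inv

theorem exists_isMoorePenrose (A : Matrix m n ℝ) : ∃ B, IsMoorePenrose A B := by
  classical
  have hS : (A.transpose * A).IsHermitian := by
    simpa using Matrix.isHermitian_conjTranspose_mul_self A
  set S := A.transpose * A with hSdef
  set d : n → ℝ := hS.eigenvalues
  set φ := Unitary.conjStarAlgAut ℝ (Matrix n n ℝ) hS.eigenvectorUnitary
  have hSφ : S = φ (Matrix.diagonal d) := by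
    exact hS.spectral_theorem
  have hsym : ∀ v : n → ℝ, (φ (Matrix.diagonal v)).transpose = φ (Matrix.diagonal v) := by
    intro v
    have h := map_star φ (Matrix.diagonal v)
    rw [Matrix.star_eq_conjTranspose, Matrix.star_eq_conjTranspose,
      Matrix.diagonal_conjTranspose] at h
    simpa using h.symm
  set T := φ (Matrix.diagonal fun i => (d i)⁻¹) with hT
  have hTsym : T.transpose = T := hsym _
  have hTS : T * S = φ (Matrix.diagonal fun i => (d i)⁻¹ * d i) := by
    rw [hSφ, hT, ← map_mul, Matrix.diagonal_mul_diagonal]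
  have hTSsym : (T * S).transpose = T * S := by rw [hTS]; exact hsym _
  have hSsym : S.transpose = S := by rw [hSφ]; exact hsym _
  have hST : S * T = T * S := by
    have := hTSsym
    rwa [Matrix.transpose_mul, hSsym, hTsym] at this
  have hSTS : S * (T * S) = S := by
    rw [hTS]
    nth_rewrite 1 [hSφ]
    rw [← map_mul, Matrix.diagonal_mul_diagonal]
    conv_rhs => rw [hSφ]
    congr 2
    funext i
    by_cases h : d i = 0
    · simp [h]
    · field_simp
  have hTST : T * S * T = T := by
    rw [hTS, hT, ← map_mul, Matrix.diagonal_mul_diagonal]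
    congr 2
    funext i
    by_cases h : d i = 0
    · simp [h]
    · field_simp
  have hA : A * (T * S) = A := by
    have hz : (A * (T * S) - A).conjTranspose * (A * (T * S) - A) = 0 := by
      have e : (A * (T * S) - A).conjTranspose = (T * S) * A.transpose - A.transpose := by
        rw [Matrix.conjTranspose_eq_transpose_of_trivial, Matrix.transpose_sub,
          Matrix.transpose_mul, hTSsym]
      have e2 : A.transpose * (A * (T * S) - A) = 0 := by
        rw [Matrix.mul_sub, ← Matrix.mul_assoc, ← hSdef, hSTS, sub_self]
      rw [e, Matrix.sub_mul, Matrix.mul_assoc, e2, Matrix.mul_zero, sub_self]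
    exact sub_eq_zero.mp (Matrix.conjTranspose_mul_self_eq_zero.mp hz)
  refine ⟨T * A.transpose, ⟨?_, ?_, ?_, ?_⟩⟩
  · rw [Matrix.mul_assoc, Matrix.mul_assoc, ← hSdef, hA]
  · rw [Matrix.mul_assoc T, ← hSdef, ← Matrix.mul_assoc, hTST]
  · rw [Matrix.transpose_mul, Matrix.transpose_mul, Matrix.transpose_transpose, hTsym,
      Matrix.mul_assoc]
  · rw [Matrix.mul_assoc, ← hSdef, hTSsym]

/-- The Moore-Penrose inverse `A⁺`. -/
def pinv (A : Matrix m n ℝ) : Matrix n m ℝ := (exists_isMoorePenrose A).choose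

theorem pinv_spec (A : Matrix m n ℝ) : IsMoorePenrose A (pinv A) :=
  (exists_isMoorePenrose A).choose_spec

end PseudoInverse

/-! ### Arms, sample generation matrices, redundancy

The alphabet is `Fin n`, and the arms are functions `g k : Fin n → ℝ`, `k : Fin K`. The rows of the
matrix of arm `k` are indexed by the range of `g k`. -/

variable {n K : ℕ}

instance outcomeFintype (f : Fin n → ℝ) : Fintype (Set.range f) := Fintype.ofFinite _

/-- The sample generation matrix of one arm: entry `1` where `f j = z`, and `0` elsewhere. -/
def sampleMatrix (f : Fin n → ℝ) : Matrix (Set.range f) (Fin n) ℝ :=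
  open Classical in Matrix.of fun z j => if f j = z then 1 else 0

/-- Pairs `(k, z)` of an arm `k` in the set `R` and an outcome `z` of that arm. -/
abbrev Row (g : Fin K → Fin n → ℝ) (R : Finset (Fin K)) : Type :=
  (k : {k // k ∈ R}) × Set.range (g k)

/-- The sample generation matrices of the arms in `R`, stacked on top of each other. -/
def stackedMatrix (g : Fin K → Fin n → ℝ) (R : Finset (Fin K)) :
    Matrix (Row g R) (Fin n) ℝ :=
  Matrix.of fun h j => sampleMatrix (g h.1) h.2 j

/-- The row space of the sample generation matrix of one arm. -/
def rowSpace (f : Fin n → ℝ) : Submodule ℝ (Fin n → ℝ) :=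
  Submodule.span ℝ (Set.range fun z => sampleMatrix f z)

/-- Arm `r` is redundant if its row space is strictly contained in that of some arm. -/
def Redundant (g : Fin K → Fin n → ℝ) (r : Fin K) : Prop :=
  ∃ s, rowSpace (g r) < rowSpace (g s)

/-- The arms that are left after elimination: the redundant arms are removed, and of several
non-redundant arms with the same row space only one is kept, the one which comes first in the
order given by the permutation `π` (a random one, if one of them is to be kept at random). -/
def keptArms (g : Fin K → Fin n → ℝ) (π : Equiv.Perm (Fin K)) : Finset (Fin K) :=
  open Classical in
  Finset.univ.filter fun k =>
    ¬ Redundant g k ∧ ∀ s, rowSpace (g s) = rowSpace (g k) → π k ≤ π s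

/-! ### The smoothed maximum likelihood estimate -/

/-- The probability of outcome `h.2` of arm `h.1` if the distribution of `X` is `P`. -/
def outProb (g : Fin K → Fin n → ℝ) (R : Finset (Fin K)) (P : Fin n → ℝ) (h : Row g R) : ℝ :=
  ∑ j, stackedMatrix g R h j * P j

/-- The smoothed log-likelihood of the distribution `P`; `N k z` is the number of times that
outcome `z` of arm `k` has been observed. -/
def logLik (g : Fin K → Fin n → ℝ) (R : Finset (Fin K)) (N : Fin K → ℝ → ℕ)
    (P : Fin n → ℝ) : ℝ :=
  ∑ h : Row g R, ((N h.1 h.2 : ℝ) + 1) * Real.log (outProb g R P h)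

/-- The probability distributions with a finite smoothed log-likelihood. (At all others it is
`-∞`, so that they do not count for the maximum.) -/
def admissible (g : Fin K → Fin n → ℝ) (R : Finset (Fin K)) : Set (Fin n → ℝ) :=
  {P | P ∈ stdSimplex ℝ (Fin n) ∧ ∀ h, 0 < outProb g R P h}

/-- `P` maximizes the smoothed log-likelihood among all probability distributions. -/
def IsSmoothedMLE (g : Fin K → Fin n → ℝ) (R : Finset (Fin K)) (N : Fin K → ℝ → ℕ)
    (P : Fin n → ℝ) : Prop :=
  P ∈ admissible g R ∧ ∀ Q ∈ admissible g R, logLik g R N Q ≤ logLik g R N P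

/-- The smoothed maximum likelihood estimate. (A maximizer exists for `n ≥ 1` by compactness, and is
unique if the stacked matrix has rank `n`.) -/
def smoothedMLE (g : Fin K → Fin n → ℝ) (R : Finset (Fin K)) (N : Fin K → ℝ → ℕ) : Fin n → ℝ :=
  open Classical in
  if h : ∃ P, IsSmoothedMLE g R N P then h.choose else fun _ => 1 / n

/-! ### The choice of the next arm -/

/-- The estimated upper bound `U(P, t)` on the mean squared error; `t k` is the number of pulls of
arm `k`. -/
def upperBound (g : Fin K → Fin n → ℝ) (R : Finset (Fin K)) (P : Fin n → ℝ) (t : Fin K → ℕ) : ℝ :=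
  ∑ j, ∑ h : Row g R, (pinv (stackedMatrix g R) j h) ^ 2 *
    (outProb g R P h * (1 - outProb g R P h) / t h.1)

/-- The decrease of the estimated upper bound if arm `k` is pulled once more. For an arm that has
not been pulled yet it is `+∞`, since `1 / t k` is infinite then. (The other arms do not
matter: their terms cancel.) -/
def decrease (g : Fin K → Fin n → ℝ) (R : Finset (Fin K)) (P : Fin n → ℝ) (t : Fin K → ℕ)
    (k : Fin K) : EReal :=
  if t k = 0 then ⊤
  else ((upperBound g R P t - upperBound g R P (t + Pi.single k 1) : ℝ) : EReal)

/-- The remaining arms with the largest decrease. -/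
def bestArms (g : Fin K → Fin n → ℝ) (R : Finset (Fin K)) (P : Fin n → ℝ) (t : Fin K → ℕ) :
    Finset (Fin K) :=
  open Classical in R.filter fun k => ∀ s ∈ R, decrease g R P t s ≤ decrease g R P t k

/-- Arm `k` is pulled next: it is the best arm which comes first in the order given by the
permutation `π`, which breaks the ties (uniformly, if `π` is a uniform random permutation). -/
def IsNextArm (g : Fin K → Fin n → ℝ) (R : Finset (Fin K)) (P : Fin n → ℝ) (t : Fin K → ℕ)
    (π : Equiv.Perm (Fin K)) (k : Fin K) : Prop :=
  k ∈ bestArms g R P t ∧ ∀ s ∈ bestArms g R P t, π k ≤ π s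

/-! ### The algorithm -/

/-- What the algorithm stores: the number of pulls of each arm, the number of times each outcome of
each arm has been observed, and the estimate of the distribution. -/
structure State (n K : ℕ) where
  pulls : Fin K → ℕ
  counts : Fin K → ℝ → ℕ
  est : Fin n → ℝ

def initState (n K : ℕ) : State n K where
  pulls := fun _ => 0
  counts := fun _ _ => 0
  est := fun _ => 1 / n

/-- One step with the remaining arms `R`, the tie-breaking order `π` and the realization `x` of
`X`: choose the next arm `k`, observe `g k x`, and update the counts and the estimate. -/
def step (g : Fin K → Fin n → ℝ) (R : Finset (Fin K)) (π : Equiv.Perm (Fin K)) (x : Fin n)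
    (S : State n K) : State n K :=
  open Classical in
  let N : Fin K → ℝ → ℕ := fun k z =>
    S.counts k z + if IsNextArm g R S.est S.pulls π k ∧ g k x = z then 1 else 0
  { pulls := fun k => S.pulls k + if IsNextArm g R S.est S.pulls π k then 1 else 0
    counts := N
    est := smoothedMLE g R N }

/-- The state after `t` steps. The permutation `π 0` is used to eliminate arms, and `π (t + 1)` to
break the ties in the choice of the arm that observes the realization `x t`. -/
def run (g : Fin K → Fin n → ℝ) (π : ℕ → Equiv.Perm (Fin K)) (x : ℕ → Fin n) : ℕ → State n K
  | 0 => initState n K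
  | t + 1 => step g (keptArms g (π 0)) (π (t + 1)) (x t) (run g π x t)

end ArmSampling

end

namespace ArmSampling

/-! ### Deterministic facts at a fixed time: the estimate, the pseudoinverse, the elimination. -/

section Static

variable {n K : ℕ} {g : Fin K → Fin n → ℝ} {R : Finset (Fin K)} {π : Equiv.Perm (Fin K)}

/-! ### Outcome probabilities -/

/-! Almost surely, the observed frequencies of every kept arm that is pulled infinitely often
converge to the true outcome probabilities (`ae_frequenciesConverge`, from a martingale strong law
that allows adaptive pulling). Everything else is deterministic, on one such sample path.

Let `P'` be a limit of the estimates `P t` along an ultrafilter. The key is to compare `P t` not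
with `p` but with `p + (P t - P')`. This is eventually a positive distribution, and it gives the
same probability as `P t` to each outcome on which `P'` and `p` agree, so only arms with some
disagreement enter the likelihood comparison. Dividing by the number of pulls of the most pulled
such arm and passing to the limit gives a strictly negative quantity that should be nonnegative,
unless `P'` agrees with `p` on all arms pulled infinitely often (`outProb_eq_of_tendsto`). No
relation between the rates of the pulls is needed. On the other arms the counts stay bounded, and
the smoothing keeps the limiting outcome probabilities positive (`outProb_pos_of_tendsto`).

One more pull of arm `k` decreases `U` by `V / (t k * (t k + 1))`, where `V` is a variance term of
the arm that stays away from zero by this positivity. For an arm with bounded pulls this would stay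
bounded below, while for an arm pulled infinitely often it tends to zero; so no kept arm can be
neglected (`tendsto_pulls`). Hence `P'` matches `p` on all kept arms, and the rank condition gives
`P' = p` (`eq_of_outProb_keptArms_eq`). Dominated convergence then handles the mean squared error.
-/

theorem outProb_eq (P : Fin n → ℝ) (h : Row g R) :
    outProb g R P h = ∑ j, if g h.1 j = h.2 then P j else 0 := by
  simp [outProb, stackedMatrix, sampleMatrix]

theorem sum_outProb (P : Fin n → ℝ) (k : {k // k ∈ R}) :
    ∑ z : Set.range (g k), outProb g R P ⟨k, z⟩ = ∑ j, P j := by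
  simp_rw [outProb_eq]
  rw [Finset.sum_comm]
  refine Finset.sum_congr rfl fun j _ => ?_
  rw [Finset.sum_eq_single ⟨g k j, j, rfl⟩]
  · simp
  · rintro ⟨z, hz⟩ - hne
    rw [if_neg]
    rintro rfl
    exact hne rfl
  · simp

theorem outProb_nonneg {P : Fin n → ℝ} (hP : ∀ j, 0 ≤ P j) (h : Row g R) :
    0 ≤ outProb g R P h := by
  rw [outProb_eq]
  exact Finset.sum_nonneg fun j _ => by split_ifs <;> simp [hP]

theorem outProb_pos {P : Fin n → ℝ} (hP : ∀ j, 0 < P j) (h : Row g R) :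
    0 < outProb g R P h := by
  rw [outProb_eq]
  obtain ⟨k, z, j, hj⟩ := h
  refine Finset.sum_pos' (fun j _ => by split_ifs <;> simp [(hP _).le]) ⟨j, Finset.mem_univ _, ?_⟩
  simp [hj, hP]

theorem outProb_le_one {P : Fin n → ℝ} (hP : P ∈ stdSimplex ℝ (Fin n)) (h : Row g R) :
    outProb g R P h ≤ 1 := by
  rw [outProb_eq, ← hP.2]
  exact Finset.sum_le_sum fun j _ => by split_ifs <;> simp [hP.1 j]

theorem continuous_outProb (h : Row g R) : Continuous fun P => outProb g R P h := by
  unfold outProb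
  fun_prop

theorem outProb_add_sub (P Q S : Fin n → ℝ) (h : Row g R) :
    outProb g R (P + (Q - S)) h = outProb g R P h + (outProb g R Q h - outProb g R S h) := by
  simp [outProb, mul_add, mul_sub, Finset.sum_add_distrib]

/-! ### Existence of the smoothed maximum likelihood estimate -/

theorem logLik_eq_log_prod {N : Fin K → ℝ → ℕ} {P : Fin n → ℝ}
    (hP : ∀ h, 0 < outProb g R P h) :
    logLik g R N P = Real.log (∏ h : Row g R, outProb g R P h ^ (N h.1 h.2 + 1)) := by
  rw [Real.log_prod fun h _ => (pow_pos (hP h) _).ne']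
  simp [logLik]

/-- The exponential of the log-likelihood is continuous on the whole compact simplex. Its value at
the positive `p` is positive, so a maximizer has no vanishing factor and is admissible. -/
theorem exists_isSmoothedMLE (N : Fin K → ℝ → ℕ) {p : Fin n → ℝ} (hp : ∀ j, 0 < p j)
    (hp1 : ∑ j, p j = 1) : ∃ P, IsSmoothedMLE g R N P := by
  have hpm : p ∈ stdSimplex ℝ (Fin n) := ⟨fun j => (hp j).le, hp1⟩
  obtain ⟨P, hP, hmax⟩ := (isCompact_stdSimplex ℝ (Fin n)).exists_isMaxOn ⟨p, hpm⟩
    (f := fun P => ∏ h : Row g R, outProb g R P h ^ (N h.1 h.2 + 1))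
    (continuous_finsetProd _ fun h _ => (continuous_outProb h).pow _).continuousOn
  have hpos : 0 < ∏ h : Row g R, outProb g R P h ^ (N h.1 h.2 + 1) :=
    (Finset.prod_pos fun h _ => pow_pos (outProb_pos hp h) _).trans_le (hmax hpm)
  have hadm : ∀ h, 0 < outProb g R P h := by
    intro h
    refine (outProb_nonneg hP.1 h).lt_of_ne' fun h0 => hpos.ne' ?_
    exact Finset.prod_eq_zero (Finset.mem_univ h) (by simp [h0])
  refine ⟨P, ⟨hP, hadm⟩, fun Q hQ => ?_⟩
  rw [logLik_eq_log_prod hadm, logLik_eq_log_prod hQ.2]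
  exact Real.log_le_log (Finset.prod_pos fun h _ => pow_pos (hQ.2 h) _) (hmax hQ.1)

theorem isSmoothedMLE_smoothedMLE (N : Fin K → ℝ → ℕ) {p : Fin n → ℝ} (hp : ∀ j, 0 < p j)
    (hp1 : ∑ j, p j = 1) : IsSmoothedMLE g R N (smoothedMLE g R N) := by
  have h := exists_isSmoothedMLE (g := g) (R := R) N hp hp1
  rw [smoothedMLE, dif_pos h]
  exact h.choose_spec

/-! ### The Moore-Penrose inverse has no vanishing column -/

/-- If column `i` of `A⁺` vanished, so would column `i` of the symmetric matrix `A A⁺`, hence its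
row `i`, hence row `i` of `A = A A⁺ A`. Consequently every outcome has a positive weight in `U`. -/
theorem exists_pinv_ne_zero {ι κ : Type*} [Fintype ι] [Fintype κ] (A : Matrix ι κ ℝ) {i : ι}
    {j : κ} (hA : A i j ≠ 0) : ∃ l, pinv A l i ≠ 0 := by
  by_contra! h
  apply hA
  have hz : ∀ i', (A * pinv A) i i' = 0 := fun i' => by
    rw [← (pinv_spec A).symm_left, Matrix.transpose_apply, Matrix.mul_apply]
    simp [h]
  rw [← (pinv_spec A).mul_mul_self, Matrix.mul_apply]
  simp [hz]

theorem exists_pinv_stackedMatrix_ne_zero (h : Row g R) :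
    ∃ j, pinv (stackedMatrix g R) j h ≠ 0 := by
  obtain ⟨k, z, j, hj⟩ := h
  exact exists_pinv_ne_zero _ (j := j) (by simp [stackedMatrix, sampleMatrix, hj])

/-! ### The remaining arms -/

theorem mem_keptArms {k : Fin K} : k ∈ keptArms g π ↔
    ¬ Redundant g k ∧ ∀ s, rowSpace (g s) = rowSpace (g k) → π k ≤ π s := by
  simp [keptArms]

theorem exists_mem_keptArms_rowSpace_eq {r : Fin K} (hr : ¬ Redundant g r) :
    ∃ k ∈ keptArms g π, rowSpace (g k) = rowSpace (g r) := by
  classical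
  obtain ⟨k, hk, hmin⟩ := Finset.exists_min_image
    (Finset.univ.filter fun k => rowSpace (g k) = rowSpace (g r)) π ⟨r, by simp⟩
  simp only [Finset.mem_filter, Finset.mem_univ, true_and] at hk hmin
  refine ⟨k, mem_keptArms.2 ⟨?_, fun s hs => hmin s (hs.trans hk)⟩, hk⟩
  rintro ⟨s, hs⟩
  exact hr ⟨s, hk ▸ hs⟩

/-- Among the finitely many row spaces, choose a maximal one above that of `r`: its arms are not
redundant, and one of them is kept. -/
theorem exists_mem_keptArms_le (r : Fin K) :
    ∃ k ∈ keptArms g π, rowSpace (g r) ≤ rowSpace (g k) := by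
  obtain ⟨V, hle, ⟨s, rfl⟩, hmax⟩ :=
    (Set.finite_range fun k => rowSpace (g k)).exists_le_maximal ⟨r, rfl⟩
  have hs : ¬ Redundant g s := by
    rintro ⟨q, hq⟩
    exact hq.not_ge (hmax ⟨q, rfl⟩ hq.le)
  obtain ⟨k, hk, hks⟩ := exists_mem_keptArms_rowSpace_eq (π := π) hs
  exact ⟨k, hk, hks ▸ hle⟩

theorem eq_of_mem_keptArms_of_rowSpace_le {k s : Fin K} (hk : k ∈ keptArms g π)
    (hs : s ∈ keptArms g π) (h : rowSpace (g k) ≤ rowSpace (g s)) : k = s := by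
  rw [mem_keptArms] at hk hs
  have heq : rowSpace (g k) = rowSpace (g s) :=
    h.eq_of_not_lt fun hlt => hk.1 ⟨s, hlt⟩
  exact π.injective (le_antisymm (hk.2 s heq.symm) (hs.2 k heq))

theorem one_mem_rowSpace (f : Fin n → ℝ) : (1 : Fin n → ℝ) ∈ rowSpace f := by
  have h : (1 : Fin n → ℝ) = ∑ z : Set.range f, fun j => sampleMatrix f z j := by
    funext j
    rw [Finset.sum_apply, Finset.sum_eq_single ⟨f j, j, rfl⟩]
    · simp [sampleMatrix]
    · rintro ⟨z, hz⟩ - hne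
      have : f j ≠ z := fun h => hne (Subtype.ext h.symm)
      simp [sampleMatrix, this]
    · simp
  rw [h]
  exact Submodule.sum_mem _ fun z _ => Submodule.subset_span ⟨z, rfl⟩

/-- A constant arm has only the all-ones vector as a row, which lies in every row space, so it
cannot survive next to another kept arm. This excludes arms of variance zero that would never be
worth a second pull. -/
theorem nontrivial_range_of_mem_keptArms {k s : Fin K} (hk : k ∈ keptArms g π)
    (hs : s ∈ keptArms g π) (hne : k ≠ s) : Nontrivial (Set.range (g k)) := by
  by_contra h
  rw [not_nontrivial_iff_subsingleton] at h
  refine hne (eq_of_mem_keptArms_of_rowSpace_le hk hs (Submodule.span_le.2 ?_))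
  rintro _ ⟨z, rfl⟩
  have : sampleMatrix (g k) z = 1 := by
    funext j
    have : g k j = z :=
      congrArg Subtype.val (Subsingleton.elim (⟨g k j, j, rfl⟩ : Set.range (g k)) z)
    simp [sampleMatrix, this]
  simpa [this] using one_mem_rowSpace (g s)

/-- Elimination loses no information: `P - Q` is orthogonal to the row spaces of the kept arms,
which contain those of all arms, and full column rank leaves only zero. -/
theorem eq_of_outProb_keptArms_eq (hA : (stackedMatrix g Finset.univ).rank = n)
    {P Q : Fin n → ℝ}
    (h : ∀ r, outProb g (keptArms g π) P r = outProb g (keptArms g π) Q r) : P = Q := by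
  have hker : ∀ r, ∀ v ∈ rowSpace (g r), v ⬝ᵥ (P - Q) = 0 := by
    intro r v hv
    obtain ⟨k, hk, hle⟩ := exists_mem_keptArms_le (g := g) (π := π) r
    refine Submodule.span_induction (p := fun v _ => v ⬝ᵥ (P - Q) = 0) ?_ (by simp) ?_ ?_ (hle hv)
    · rintro _ ⟨z, rfl⟩
      rw [dotProduct_sub, sub_eq_zero]
      exact h ⟨⟨k, hk⟩, z⟩
    · intro x y _ _ hx hy
      rw [add_dotProduct, hx, hy, add_zero]
    · intro a x _ hx
      rw [smul_dotProduct, hx, smul_zero]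
  have hinj : Function.Injective (stackedMatrix g Finset.univ).mulVec := by
    rw [Matrix.mulVec_injective_iff, linearIndependent_iff_card_eq_finrank_span,
      Fintype.card_fin]
    exact hA.symm.trans (Matrix.rank_eq_finrank_span_cols _)
  refine hinj (sub_eq_zero.1 ?_)
  rw [← Matrix.mulVec_sub]
  funext r
  exact hker r.1 _ (Submodule.subset_span ⟨r.2, rfl⟩)

end Static

end ArmSampling

namespace ArmSampling

section LimitPoints

variable {n K : ℕ} {g : Fin K → Fin n → ℝ} {R : Finset (Fin K)} {ι : Type*} {U : Ultrafilter ι}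
  {N : ι → Fin K → ℝ → ℕ} {T : ι → Fin K → ℕ} {P : ι → Fin n → ℝ} {P' p : Fin n → ℝ}

/-! ### Limit points of the smoothed maximum likelihood estimate -/

theorem tendsto_outProb_add_sub (hP : Tendsto P U (𝓝 P')) (h : Row g R) :
    Tendsto (fun t => outProb g R (p + (P t - P')) h) U (𝓝 (outProb g R p h)) := by
  have : Tendsto (fun t => p + (P t - P')) U (𝓝 p) := by
    simpa using (hP.sub_const P').const_add p
  exact ((continuous_outProb h).tendsto p).comp this

/-- The competitor has total mass one because `P t` and `P'` do, and it tends to the strictly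
positive `p`. -/
theorem eventually_add_sub_mem_admissible (hp : ∀ j, 0 < p j) (hp1 : ∑ j, p j = 1)
    (hPs : ∀ᶠ t in U, P t ∈ stdSimplex ℝ (Fin n)) (hP : Tendsto P U (𝓝 P')) :
    ∀ᶠ t in U, p + (P t - P') ∈ admissible g R := by
  have hP's : P' ∈ stdSimplex ℝ (Fin n) := (isClosed_stdSimplex ℝ (Fin n)).mem_of_tendsto hP hPs
  have hlim : Tendsto (fun t => p + (P t - P')) U (𝓝 p) := by
    simpa using (hP.sub_const P').const_add p
  have hpos : ∀ᶠ t in U, ∀ j, 0 < (p + (P t - P')) j :=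
    eventually_all.2 fun j => (tendsto_pi_nhds.1 hlim j).eventually_const_lt (hp j)
  filter_upwards [hPs, hpos] with t hPt ht
  refine ⟨⟨fun j => (ht j).le, ?_⟩, outProb_pos ht⟩
  simp [Finset.sum_add_distrib, hp1, hPt.2, hP's.2]

theorem eventually_sum_log_sub_log_nonneg (hp : ∀ j, 0 < p j) (hp1 : ∑ j, p j = 1)
    (hmle : ∀ᶠ t in U, IsSmoothedMLE g R (N t) (P t)) (hP : Tendsto P U (𝓝 P')) :
    ∀ᶠ t in U, 0 ≤ ∑ h : Row g R, ((N t h.1 h.2 : ℝ) + 1) *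
      (Real.log (outProb g R (P t) h) - Real.log (outProb g R (p + (P t - P')) h)) := by
  filter_upwards [hmle, eventually_add_sub_mem_admissible (g := g) (R := R) hp hp1
    (hmle.mono fun t ht => ht.1.1) hP] with t ht hadm
  have := ht.2 _ hadm
  simp only [mul_sub, Finset.sum_sub_distrib]
  exact sub_nonneg.2 this

/-- Letting a probability tend to zero would cost an unbounded amount through its pseudo-count 1,
while the possible gain over the competitor on outcomes of disagreement is bounded, since their
counts are. Outcomes of agreement cancel. -/
theorem outProb_pos_of_tendsto (hp : ∀ j, 0 < p j) (hp1 : ∑ j, p j = 1)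
    (hmle : ∀ᶠ t in U, IsSmoothedMLE g R (N t) (P t)) (hP : Tendsto P U (𝓝 P')) {B : Row g R → ℝ}
    (hB : ∀ h : Row g R, outProb g R P' h = outProb g R p h ∨ ∀ᶠ t in U, N t h.1 h.2 ≤ B h)
    (h : Row g R) : 0 < outProb g R P' h := by
  classical
  by_cases hne : outProb g R P' h = outProb g R p h
  · exact hne ▸ outProb_pos hp h
  set c : Row g R → ℝ → ℝ := fun r q =>
    if outProb g R P' r = outProb g R p r then 0 else (B r + 1) * Real.log q with hc
  have hadm := eventually_add_sub_mem_admissible (g := g) (R := R) hp hp1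
    (hmle.mono fun t ht => ht.1.1) hP
  have hB' : ∀ᶠ t in U, ∀ r : Row g R, outProb g R P' r ≠ outProb g R p r →
      N t r.1 r.2 ≤ B r := eventually_all.2 fun r => by
    rcases hB r with h1 | h1
    · exact Eventually.of_forall fun t h2 => absurd h1 h2
    · exact h1.mono fun t ht _ => ht
  have hle : ∀ᶠ t in U,
      Real.exp (∑ r : Row g R, c r (outProb g R (p + (P t - P')) r)) ≤ outProb g R (P t) h := by
    filter_upwards [hadm, hB', hmle, eventually_sum_log_sub_log_nonneg hp hp1 hmle hP]
      with t hadm hBt hmt hsum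
    rw [← Real.le_log_iff_exp_le (hmt.1.2 h)]
    have hlogP : ∀ r, Real.log (outProb g R (P t) r) ≤ 0 := fun r =>
      Real.log_nonpos (hmt.1.2 r).le (outProb_le_one hmt.1.1 r)
    have hlogQ : ∀ r, Real.log (outProb g R (p + (P t - P')) r) ≤ 0 := fun r =>
      Real.log_nonpos (hadm.2 r).le (outProb_le_one hadm.1 r)
    -- The pseudo-count provides the single copy of `log (outProb g R (P t) h)` that is kept; all
    -- other logarithms of `P t` are nonpositive and can be dropped.
    have hterm : ∀ r : Row g R, ((N t r.1 r.2 : ℝ) + 1) *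
        (Real.log (outProb g R (P t) r) - Real.log (outProb g R (p + (P t - P')) r)) ≤
        (if r = h then Real.log (outProb g R (P t) h) else 0)
          - c r (outProb g R (p + (P t - P')) r) := by
      intro r
      have hN : (0 : ℝ) ≤ N t r.1 r.2 := Nat.cast_nonneg _
      by_cases hr : outProb g R P' r = outProb g R p r
      · have hrh : r ≠ h := fun e => hne (e ▸ hr)
        -- Where `P'` and `p` agree, the estimate and the competitor give equal probabilities and
        -- the term is zero.
        rw [outProb_add_sub, ← hr]
        simp [hc, hr, hrh]
      · have h1 := hBt r hr
        have h2 : ((N t r.1 r.2 : ℝ) + 1) * Real.log (outProb g R (P t) r) ≤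
            if r = h then Real.log (outProb g R (P t) h) else 0 := by
          split_ifs with e
          · subst e; nlinarith [hlogP r]
          · nlinarith [hlogP r]
        simp only [hc, if_neg hr]
        nlinarith [hlogQ r]
    have := hsum.trans (Finset.sum_le_sum fun r _ => hterm r)
    simpa [Finset.sum_sub_distrib] using this
  have hlim : Tendsto (fun t => Real.exp (∑ r : Row g R, c r (outProb g R (p + (P t - P')) r))) U
      (𝓝 (Real.exp (∑ r : Row g R, c r (outProb g R p r)))) := by
    refine (Real.continuous_exp.tendsto _).comp (tendsto_finsetSum _ fun r _ => ?_)
    have hr := tendsto_outProb_add_sub (p := p) hP r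
    by_cases e : outProb g R P' r = outProb g R p r
    · simp [hc, e]
    · simp only [hc, if_neg e]
      exact (hr.log (outProb_pos hp r).ne').const_mul _
  exact (Real.exp_pos _).trans_le (le_of_tendsto_of_tendsto hlim
    (((continuous_outProb h).tendsto P').comp hP) hle)

/-- Completing the square: after summation over the outcomes the term `r - q` cancels, and minus a
weighted sum of squares remains. -/
theorem two_mul_sqrt_div_sub_one {q r : ℝ} (hq : 0 < q) (hr : 0 ≤ r) :
    q * (2 * (√(r / q) - 1)) = (r - q) - q * (√(r / q) - 1) ^ 2 := by
  have h : √(r / q) ^ 2 = r / q := Real.sq_sqrt (div_nonneg hr hq.le)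
  have h2 : q * (r / q) = r := by field_simp
  linear_combination q * h + h2

theorem sum_mul_two_mul_sqrt_div_sub_one_nonpos {α : Type*} [Fintype α] {q r : α → ℝ}
    (hq : ∀ z, 0 < q z) (hr : ∀ z, 0 ≤ r z) (hs : ∑ z, r z = ∑ z, q z) :
    ∑ z, q z * (2 * (√(r z / q z) - 1)) ≤ 0 := by
  simp_rw [fun z => two_mul_sqrt_div_sub_one (hq z) (hr z)]
  rw [Finset.sum_sub_distrib, Finset.sum_sub_distrib, hs, sub_self, zero_sub, neg_nonpos]
  exact Finset.sum_nonneg fun z _ => mul_nonneg (hq z).le (sq_nonneg _)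

theorem sum_mul_two_mul_sqrt_div_sub_one_neg {α : Type*} [Fintype α] {q r : α → ℝ}
    (hq : ∀ z, 0 < q z) (hr : ∀ z, 0 ≤ r z) (hs : ∑ z, r z = ∑ z, q z) {z₀ : α}
    (hne : r z₀ ≠ q z₀) : ∑ z, q z * (2 * (√(r z / q z) - 1)) < 0 := by
  simp_rw [fun z => two_mul_sqrt_div_sub_one (hq z) (hr z)]
  rw [Finset.sum_sub_distrib, Finset.sum_sub_distrib, hs, sub_self, zero_sub, neg_lt_zero]
  refine Finset.sum_pos' (fun z _ => mul_nonneg (hq z).le (sq_nonneg _)) ⟨z₀, Finset.mem_univ _, ?_⟩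
  refine mul_pos (hq z₀) (sq_pos_of_ne_zero fun h => hne ?_)
  rw [sub_eq_zero, Real.sqrt_eq_one, div_eq_one_iff_eq (hq z₀).ne'] at h
  exact h

/-- This is `log u ≤ u - 1` at the square root of the ratio. The bound remains continuous when `x`
tends to zero, so the limit can be taken before the limiting probabilities are known to be positive.
-/
theorem log_sub_log_le_two_mul_sqrt {x y : ℝ} (hx : 0 < x) (hy : 0 < y) :
    Real.log x - Real.log y ≤ 2 * (√(x / y) - 1) := by
  rw [← Real.log_div hx.ne' hy.ne']
  have h := Real.log_le_sub_one_of_pos (Real.sqrt_pos.2 (div_pos hx hy))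
  rw [Real.log_sqrt (div_pos hx hy).le] at h
  linarith

/-- A limit point of the smoothed maximum likelihood estimates reproduces the outcome probabilities
of the arms that are pulled infinitely often, whatever the relative rates of the pulls. -/
theorem outProb_eq_of_tendsto (hp : ∀ j, 0 < p j) (hp1 : ∑ j, p j = 1)
    (hmle : ∀ᶠ t in U, IsSmoothedMLE g R (N t) (P t)) (hP : Tendsto P U (𝓝 P'))
    (hNT : ∀ t k z, N t k z ≤ T t k)
    (hT : ∀ k : {k // k ∈ R}, Tendsto (fun t => T t k) U atTop ∨ ∃ B, ∀ᶠ t in U, T t k ≤ B)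
    (hfreq : ∀ h : Row g R, Tendsto (fun t => T t h.1) U atTop →
      Tendsto (fun t => (N t h.1 h.2 : ℝ) / T t h.1) U (𝓝 (outProb g R p h)))
    (h : Row g R) (hh : Tendsto (fun t => T t h.1) U atTop) :
    outProb g R P' h = outProb g R p h := by
  classical
  by_contra hne
  have hP's : P' ∈ stdSimplex ℝ (Fin n) :=
    (isClosed_stdSimplex ℝ (Fin n)).mem_of_tendsto hP (hmle.mono fun t ht => ht.1.1)
  -- The arms on which `P'` and `p` disagree somewhere; only they contribute to the likelihood
  -- comparison.
  set D : Finset {k // k ∈ R} := Finset.univ.filter fun k =>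
    ∃ z, outProb g R P' ⟨k, z⟩ ≠ outProb g R p ⟨k, z⟩ with hD
  have hhD : h.1 ∈ D := by simpa [hD] using ⟨h.2.1, h.2.2, hne⟩
  -- the arm of `D` with the largest number of pulls along `U`
  obtain ⟨s, hs, hsmax⟩ : ∃ s ∈ D, ∀ᶠ t in U, ∀ k ∈ D, T t k ≤ T t s := by
    have h1 : ∀ᶠ t in U, ∃ s ∈ D, ∀ k ∈ D, T t k ≤ T t s :=
      Eventually.of_forall fun t => D.exists_max_image (fun k => T t k) ⟨_, hhD⟩
    exact (Ultrafilter.eventually_exists_mem_iff D.finite_toSet).1 h1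
  have hsT : Tendsto (fun t => T t s) U atTop :=
    tendsto_atTop_mono' _ (hsmax.mono fun t ht => ht _ hhD) hh
  have hsTr : Tendsto (fun t => (T t s : ℝ)) U atTop := tendsto_natCast_atTop_atTop.comp hsT
  have hspos : ∀ᶠ t in U, (0 : ℝ) < T t s := hsTr.eventually_gt_atTop 0
  have hratio : ∀ k : {k // k ∈ R}, ∃ ρ : ℝ, k ∈ D →
      0 ≤ ρ ∧ Tendsto (fun t => (T t k : ℝ) / T t s) U (𝓝 ρ) := by
    intro k
    by_cases hk : k ∈ D
    swap
    · exact ⟨0, fun h => absurd h hk⟩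
    have hIcc : ∀ᶠ t in U, (T t k : ℝ) / T t s ∈ Set.Icc (0 : ℝ) 1 := by
      filter_upwards [hsmax, hspos] with t ht h0
      exact ⟨by positivity, (div_le_one h0).2 (by exact_mod_cast ht k hk)⟩
    obtain ⟨ρ, hρ, hle⟩ := isCompact_Icc.ultrafilter_le_nhds
      (U.map fun t => (T t k : ℝ) / T t s) (le_principal_iff.2 hIcc)
    exact ⟨ρ, fun _ => ⟨hρ.1, hle⟩⟩
  choose ρ hρ using hratio
  have hρs : ρ s = 1 := by
    refine tendsto_nhds_unique (hρ s hs).2 (tendsto_const_nhds.congr' ?_)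
    filter_upwards [hspos] with t ht
    rw [div_self ht.ne']
  have hcoef : ∀ r : Row g R, r.1 ∈ D →
      Tendsto (fun t => ((N t r.1 r.2 : ℝ) + 1) / T t s) U (𝓝 (ρ r.1 * outProb g R p r)) := by
    intro r hr
    have hinv : ∀ C : ℝ, Tendsto (fun t => C / (T t s : ℝ)) U (𝓝 0) := fun C =>
      hsTr.const_div_atTop C
    rcases hT r.1 with h1 | ⟨B, hB⟩
    · have h2 := ((hρ r.1 hr).2.mul (hfreq r h1)).add (hinv 1)
      rw [add_zero] at h2
      refine h2.congr' ?_
      filter_upwards [h1.eventually_gt_atTop 0, hspos] with t ht ht2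
      have : (0 : ℝ) < T t r.1 := by exact_mod_cast ht
      field_simp
    · have h0 : ρ r.1 = 0 := by
        refine tendsto_nhds_unique (hρ r.1 hr).2 (squeeze_zero' (Eventually.of_forall fun t =>
          by positivity) ?_ (hinv B))
        filter_upwards [hB] with t ht
        gcongr
      rw [h0, zero_mul]
      refine squeeze_zero' (Eventually.of_forall fun t => by positivity) ?_ (hinv (B + 1))
      filter_upwards [hB] with t ht
      have : (N t r.1 r.2 : ℝ) ≤ B := by exact_mod_cast (hNT t _ _).trans ht
      gcongr
  set G : Row g R → ι → ℝ := fun r t => if r.1 ∈ D then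
    ((N t r.1 r.2 : ℝ) + 1) / T t s *
      (2 * (√(outProb g R (P t) r / outProb g R (p + (P t - P')) r) - 1)) else 0 with hG
  set G' : Row g R → ℝ := fun r => if r.1 ∈ D then
    ρ r.1 * (outProb g R p r * (2 * (√(outProb g R P' r / outProb g R p r) - 1))) else 0 with hG'
  have hGlim : Tendsto (fun t => ∑ r, G r t) U (𝓝 (∑ r, G' r)) := by
    refine tendsto_finsetSum _ fun r _ => ?_
    by_cases hr : r.1 ∈ D
    · simp only [hG, hG', if_pos hr, ← mul_assoc (ρ r.1)]
      have h1 := (((continuous_outProb r).tendsto P').comp hP).div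
        (tendsto_outProb_add_sub (p := p) hP r) (outProb_pos hp r).ne'
      exact (hcoef r hr).mul ((h1.sqrt.sub_const 1).const_mul 2)
    · simp [hG, hG', hr]
  have hGnonneg : ∀ᶠ t in U, 0 ≤ ∑ r, G r t := by
    filter_upwards [hmle, hspos, eventually_add_sub_mem_admissible (g := g) (R := R) hp hp1
      (hmle.mono fun t ht => ht.1.1) hP, eventually_sum_log_sub_log_nonneg hp hp1 hmle hP]
      with t hmt hst hadm hsum
    have h1 := div_nonneg hsum hst.le
    rw [Finset.sum_div] at h1
    refine h1.trans (Finset.sum_le_sum fun r _ => ?_)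
    by_cases hr : r.1 ∈ D
    · simp only [hG, if_pos hr]
      rw [mul_div_right_comm]
      exact mul_le_mul_of_nonneg_left (log_sub_log_le_two_mul_sqrt (hmt.1.2 r) (hadm.2 r))
        (by positivity)
    · have hr' : outProb g R P' r = outProb g R p r := by
        by_contra h2
        exact hr (by simpa [hD] using ⟨r.2.1, r.2.2, h2⟩)
      rw [outProb_add_sub, ← hr']
      simp [hG, hr]
  have hnonneg : 0 ≤ ∑ r, G' r := ge_of_tendsto hGlim hGnonneg
  refine hnonneg.not_gt ?_
  -- Both distributions have mass one on each arm, so each arm contributes at most zero; arm `s`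
  -- contributes strictly less, with weight `ρ s = 1`.
  have hsumeq : ∀ k : {k // k ∈ R},
      ∑ z, outProb g R P' ⟨k, z⟩ = ∑ z, outProb g R p ⟨k, z⟩ := fun k => by
    rw [sum_outProb, sum_outProb, hP's.2, hp1]
  have hinner : ∀ k, ∑ z, G' ⟨k, z⟩ = if k ∈ D then ρ k * ∑ z, outProb g R p ⟨k, z⟩ *
      (2 * (√(outProb g R P' ⟨k, z⟩ / outProb g R p ⟨k, z⟩) - 1)) else 0 := by
    intro k
    by_cases hk : k ∈ D
    · simp only [hG', if_pos hk, Finset.mul_sum]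
    · simp [hG', hk]
  rw [Fintype.sum_sigma]
  simp_rw [hinner]
  refine (Finset.sum_lt_sum (g := fun _ => 0) (fun k _ => ?_) ⟨s, Finset.mem_univ _, ?_⟩).trans_eq
    Finset.sum_const_zero
  · split_ifs with hk
    · exact mul_nonpos_of_nonneg_of_nonpos (hρ k hk).1
        (sum_mul_two_mul_sqrt_div_sub_one_nonpos (fun z => outProb_pos hp _)
          (fun z => outProb_nonneg hP's.1 _) (hsumeq k))
    · exact le_rfl
  · rw [if_pos hs, hρs, one_mul]
    obtain ⟨z, hz⟩ := (Finset.mem_filter.1 hs).2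
    exact sum_mul_two_mul_sqrt_div_sub_one_neg (fun z => outProb_pos hp _)
      (fun z => outProb_nonneg hP's.1 _) (hsumeq s) hz

end LimitPoints

end ArmSampling

namespace ArmSampling

/-! ### A strong law for adaptively selected martingale differences. -/

section StrongLaw

/-- Kronecker's lemma: summation by parts expresses the sum through the tails `Z` of the convergent
series, and weighted averages of a null sequence tend to zero. The `+ 1` makes the weights
meaningful before the first pull. -/
theorem tendsto_sum_mul_div_sum {a ξ : ℕ → ℝ} (ha : ∀ t, 0 ≤ a t) {L : ℝ}
    (hY : Tendsto (fun t => ∑ s ∈ Finset.range t,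
      a s / ((∑ r ∈ Finset.range s, a r) + 1) * ξ s) atTop (𝓝 L))
    (hsum : Tendsto (fun t => ∑ s ∈ Finset.range t, a s) atTop atTop) :
    Tendsto (fun t => (∑ s ∈ Finset.range t, a s * ξ s) / ∑ s ∈ Finset.range t, a s)
      atTop (𝓝 0) := by
  set b : ℕ → ℝ := fun t => ∑ r ∈ Finset.range t, a r with hb
  set Z : ℕ → ℝ := fun t => (∑ s ∈ Finset.range t, a s / (b s + 1) * ξ s) - L with hZ
  have hb0 : ∀ t, 0 ≤ b t := fun t => Finset.sum_nonneg fun s _ => ha s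
  have hZ0 : Tendsto Z atTop (𝓝 0) := by simpa using hY.sub_const L
  have hparts : ∀ t, ∑ s ∈ Finset.range t, a s * ξ s
      = (b t + 1) * Z t - Z 0 - ∑ s ∈ Finset.range t, a s * Z (s + 1) := by
    intro t
    induction t with
    | zero => simp [hb]
    | succ t ih =>
      have e1 : b (t + 1) = b t + a t := Finset.sum_range_succ _ _
      have e2 : Z (t + 1) = Z t + a t / (b t + 1) * ξ t := by
        simp only [hZ, Finset.sum_range_succ]; ring
      have e3 : (b t + 1) * (a t / (b t + 1)) = a t := by
        have := hb0 t
        field_simp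
      rw [Finset.sum_range_succ, Finset.sum_range_succ, ih, e1, e2]
      linear_combination (-ξ t) * e3
  have hO : (fun t => a t * Z (t + 1)) =o[atTop] a := by
    have h1 := (Asymptotics.isBigO_refl a atTop).mul_isLittleO
      ((Asymptotics.isLittleO_one_iff ℝ).2 (hZ0.comp (tendsto_add_atTop_nat 1)))
    simpa using h1
  have h3 := (hO.sum_range ha hsum).tendsto_div_nhds_zero
  have hinv : Tendsto (fun t => (b t)⁻¹) atTop (𝓝 0) := tendsto_inv_atTop_zero.comp hsum
  have h4 : Tendsto (fun t => Z t + Z t * (b t)⁻¹ - Z 0 * (b t)⁻¹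
      - (∑ s ∈ Finset.range t, a s * Z (s + 1)) / b t) atTop (𝓝 0) := by
    simpa using ((hZ0.add (hZ0.mul hinv)).sub (hinv.const_mul (Z 0))).sub h3
  refine h4.congr' ?_
  filter_upwards [hsum.eventually_gt_atTop 0] with t ht
  have ht' : b t ≠ 0 := ne_of_gt ht
  rw [show ∑ s ∈ Finset.range t, a s = b t from rfl, hparts t]
  field_simp

variable {Ω : Type*} {mΩ : MeasurableSpace Ω} {μ : Measure Ω} [IsProbabilityMeasure μ]

theorem integral_mul_eq_zero_of_condExp_eq_zero {m : MeasurableSpace Ω} (hm : m ≤ mΩ)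
    {f ξ : Ω → ℝ} (hf : StronglyMeasurable[m] f) (hfξ : Integrable (f * ξ) μ)
    (hξ : Integrable ξ μ) (h0 : μ[ξ | m] =ᵐ[μ] 0) : ∫ ω, f ω * ξ ω ∂μ = 0 := by
  have h1 := condExp_mul_of_stronglyMeasurable_left hf hfξ hξ
  have h2 : ∫ ω, (f * ξ) ω ∂μ = 0 := by
    rw [← integral_condExp hm]
    refine integral_eq_zero_of_ae (h1.trans ?_)
    filter_upwards [h0] with ω hω
    simp [hω]
  exact h2

/-- The martingale with increments `a t * ξ t / (1 + number of earlier selections)` is bounded in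
L², because the inverse squares of the successive denominators are summable; it converges almost
surely, and Kronecker's lemma applies. -/
theorem ae_tendsto_sum_mul_div_sum {ℱ : Filtration ℕ mΩ} {a ξ : ℕ → Ω → ℝ}
    (ham : ∀ t, StronglyMeasurable[ℱ t] (a t)) (ha : ∀ t ω, a t ω = 0 ∨ a t ω = 1)
    (hξm : ∀ t, StronglyMeasurable[ℱ (t + 1)] (ξ t)) (hξ1 : ∀ t ω, |ξ t ω| ≤ 1)
    (hξ0 : ∀ t, μ[ξ t | ℱ t] =ᵐ[μ] 0) :
    ∀ᵐ ω ∂μ, Tendsto (fun t => ∑ s ∈ Finset.range t, a s ω) atTop atTop →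
      Tendsto (fun t => (∑ s ∈ Finset.range t, a s ω * ξ s ω) / ∑ s ∈ Finset.range t, a s ω)
        atTop (𝓝 0) := by
  set b : ℕ → Ω → ℝ := fun t ω => (∑ r ∈ Finset.range t, a r ω) + 1 with hb
  set w : ℕ → Ω → ℝ := fun t ω => a t ω / b t ω with hw
  set Y : ℕ → Ω → ℝ := fun t ω => ∑ s ∈ Finset.range t, w s ω * ξ s ω with hY
  have ha0 : ∀ t ω, 0 ≤ a t ω := fun t ω => by rcases ha t ω with h | h <;> simp [h]
  have hb1 : ∀ t ω, 1 ≤ b t ω := fun t ω => by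
    have := Finset.sum_nonneg fun s (_ : s ∈ Finset.range t) => ha0 s ω
    simp only [hb]; linarith
  have hbs : ∀ t ω, b (t + 1) ω = b t ω + a t ω := fun t ω => by
    simp only [hb, Finset.sum_range_succ]; ring
  have hbm : ∀ t, StronglyMeasurable[ℱ t] (b t) := fun t =>
    (Finset.stronglyMeasurable_fun_sum _ fun s hs =>
      (ham s).mono (ℱ.mono (Finset.mem_range.1 hs).le)).add stronglyMeasurable_const
  have hwm : ∀ t, StronglyMeasurable[ℱ t] (w t) := fun t => (ham t).div (hbm t)
  have hw1 : ∀ t ω, |w t ω| ≤ 1 := fun t ω => by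
    have := hb1 t ω
    rw [abs_of_nonneg (div_nonneg (ha0 t ω) (by linarith)), div_le_one (by linarith)]
    rcases ha t ω with h | h <;> linarith
  have hwξ1 : ∀ t ω, |w t ω * ξ t ω| ≤ 1 := fun t ω => by
    rw [abs_mul]
    exact mul_le_one₀ (hw1 t ω) (abs_nonneg _) (hξ1 t ω)
  have hYm : ∀ t, StronglyMeasurable[ℱ t] (Y t) := fun t =>
    Finset.stronglyMeasurable_fun_sum _ fun s hs =>
      ((hwm s).mono (ℱ.mono (Finset.mem_range.1 hs).le)).mul
        ((hξm s).mono (ℱ.mono (Finset.mem_range.1 hs)))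
  have hYb : ∀ t ω, |Y t ω| ≤ t := fun t ω => by
    refine (Finset.abs_sum_le_sum_abs _ _).trans ?_
    simpa using Finset.sum_le_sum fun s (_ : s ∈ Finset.range t) => hwξ1 s ω
  have hbdd : ∀ {f : Ω → ℝ} (C : ℝ), StronglyMeasurable f → (∀ ω, |f ω| ≤ C) → Integrable f μ :=
    fun C hf hC => Integrable.of_bound hf.aestronglyMeasurable C (ae_of_all _ hC)
  have hξi : ∀ t, Integrable (ξ t) μ := fun t => hbdd 1 ((hξm t).mono (ℱ.le _)) (hξ1 t)
  have hwξs : ∀ t, StronglyMeasurable fun ω => w t ω * ξ t ω := fun t =>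
    ((hwm t).mono (ℱ.le _)).mul ((hξm t).mono (ℱ.le _))
  have hYs : ∀ t, StronglyMeasurable (Y t) := fun t => (hYm t).mono (ℱ.le _)
  have hYi : ∀ t, Integrable (Y t) μ := fun t => hbdd t (hYs t) (hYb t)
  have hmart : Martingale Y ℱ μ := by
    refine martingale_of_condExp_sub_eq_zero_nat hYm hYi fun t => ?_
    have e : Y (t + 1) - Y t = w t * ξ t := by
      funext ω; simp [hY, Finset.sum_range_succ]
    rw [e]
    refine (condExp_mul_of_stronglyMeasurable_left (hwm t) (hbdd 1 (hwξs t) (hwξ1 t))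
      (hξi t)).trans ?_
    filter_upwards [hξ0 t] with ω hω
    simp [hω]
  have hY2i : ∀ t, Integrable (fun ω => Y t ω ^ 2) μ := fun t =>
    hbdd ((t : ℝ) ^ 2) ((hYs t).pow 2) fun ω => by
      rw [abs_pow]; exact pow_le_pow_left₀ (abs_nonneg _) (hYb t ω) 2
  have hbi : ∀ t, Integrable (fun ω => 2 / b t ω) μ := fun t =>
    hbdd 2 (stronglyMeasurable_const.div ((hbm t).mono (ℱ.le _))) fun ω => by
      have := hb1 t ω
      rw [abs_of_nonneg (by positivity)]
      exact div_le_self (by norm_num) this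
  have hVi : ∀ t, Integrable (fun ω => Y t ω ^ 2 + 2 / b t ω) μ := fun t => (hY2i t).add (hbi t)
  -- The potential `Y² + 2 / b` does not increase in mean: a selection adds at most `1 / b²` to the
  -- mean square and lowers `2 / b` by `2 / (b * (b + 1)) ≥ 1 / b²`, as `b ≥ 1`. It starts at 2.
  have hpot : ∀ t, ∫ ω, (Y t ω ^ 2 + 2 / b t ω) ∂μ ≤ 2 := by
    intro t
    induction t with
    | zero => simp [hY, hb]
    | succ t ih =>
      have hYw1 : ∀ ω, |2 * Y t ω * w t ω * ξ t ω| ≤ 2 * t := fun ω => by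
        rw [mul_assoc, abs_mul, abs_mul, abs_two]
        have := mul_le_mul (hYb t ω) (hwξ1 t ω) (abs_nonneg _) (Nat.cast_nonneg t)
        linarith
      have hYwm : StronglyMeasurable[ℱ t] fun ω => 2 * Y t ω * w t ω :=
        (stronglyMeasurable_const.mul (hYm t)).mul (hwm t)
      have hint : Integrable (fun ω => 2 * Y t ω * w t ω * ξ t ω) μ :=
        hbdd _ ((hYwm.mono (ℱ.le _)).mul ((hξm t).mono (ℱ.le _))) hYw1
      have hcross : ∫ ω, 2 * Y t ω * w t ω * ξ t ω ∂μ = 0 :=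
        integral_mul_eq_zero_of_condExp_eq_zero (ℱ.le t) hYwm hint (hξi t) (hξ0 t)
      calc ∫ ω, (Y (t + 1) ω ^ 2 + 2 / b (t + 1) ω) ∂μ
          ≤ ∫ ω, ((Y t ω ^ 2 + 2 / b t ω) + 2 * Y t ω * w t ω * ξ t ω) ∂μ := by
            refine integral_mono (hVi _) ((hVi _).add hint)
              fun ω => ?_
            have hb := hb1 t ω
            have e : Y (t + 1) ω = Y t ω + w t ω * ξ t ω := Finset.sum_range_succ _ _
            have hs : ξ t ω ^ 2 ≤ 1 := by
              rw [← sq_abs]; exact pow_le_one₀ (abs_nonneg _) (hξ1 t ω)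
            have hkey : w t ω ^ 2 + 2 / b (t + 1) ω ≤ 2 / b t ω := by
              rw [hbs]
              rcases ha t ω with h | h
              · simp [hw, h]
              · simp only [hw, h]
                rw [div_pow, div_add_div _ _ (by positivity) (by positivity),
                  div_le_div_iff₀ (by positivity) (by positivity)]
                nlinarith [sq_nonneg (b t ω)]
            have hws : w t ω ^ 2 * ξ t ω ^ 2 ≤ w t ω ^ 2 :=
              mul_le_of_le_one_right (sq_nonneg _) hs
            simp only [e]
            nlinarith
        _ = ∫ ω, (Y t ω ^ 2 + 2 / b t ω) ∂μ := by
            rw [integral_add (hVi _) hint, hcross, add_zero]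
        _ ≤ 2 := ih
  -- From `|Y| ≤ Y² + 1` and the bound 2 on the potential.
  have hL1 : ∀ t, eLpNorm (Y t) 1 μ ≤ (3 : NNReal) := by
    intro t
    rw [eLpNorm_one_eq_lintegral_enorm, ← ofReal_integral_norm_eq_lintegral_enorm (hYi t)]
    refine ENNReal.ofReal_le_of_le_toReal ?_
    have h : ∫ ω, ‖Y t ω‖ ∂μ ≤ ∫ ω, ((Y t ω ^ 2 + 2 / b t ω) + 1) ∂μ := by
      refine integral_mono (hYi t).norm
        ((hVi t).add (integrable_const 1)) fun ω => ?_
      have : 0 ≤ 2 / b t ω := div_nonneg (by norm_num) (zero_le_one.trans (hb1 t ω))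
      simp only [Real.norm_eq_abs]
      nlinarith [sq_abs (Y t ω), sq_nonneg (|Y t ω| - 1), abs_nonneg (Y t ω)]
    rw [integral_add (hVi t) (integrable_const 1)] at h
    have := hpot t
    simp at h ⊢
    linarith
  filter_upwards [hmart.submartingale.exists_ae_tendsto_of_bdd hL1] with ω ⟨L, hL⟩ hsum
  exact tendsto_sum_mul_div_sum (fun t => ha0 t ω) hL hsum

end StrongLaw

end ArmSampling

namespace ArmSampling

section Decrease

variable {n K : ℕ} {g : Fin K → Fin n → ℝ} {R : Finset (Fin K)}

/-! ### The decrease of the estimated upper bound -/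

/-- The contribution of arm `k` to the estimated upper bound, multiplied by its number of pulls. -/
noncomputable def armVariance (g : Fin K → Fin n → ℝ) (R : Finset (Fin K)) (P : Fin n → ℝ)
    (k : {k // k ∈ R}) : ℝ :=
  ∑ z : Set.range (g k), (∑ j, pinv (stackedMatrix g R) j ⟨k, z⟩ ^ 2) *
    (outProb g R P ⟨k, z⟩ * (1 - outProb g R P ⟨k, z⟩))

theorem upperBound_eq (P : Fin n → ℝ) (t : Fin K → ℕ) :
    upperBound g R P t = ∑ k : {k // k ∈ R}, armVariance g R P k / t k := by
  rw [upperBound, Finset.sum_comm, Fintype.sum_sigma]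
  refine Finset.sum_congr rfl fun k _ => ?_
  rw [armVariance, Finset.sum_div]
  refine Finset.sum_congr rfl fun z _ => ?_
  rw [← Finset.sum_mul]
  simp only [mul_div_assoc]

theorem decrease_eq {P : Fin n → ℝ} {t : Fin K → ℕ} (k : {k // k ∈ R}) (hk : t k ≠ 0) :
    decrease g R P t k =
      ((armVariance g R P k * (1 / (t k : ℝ) - 1 / ((t k : ℝ) + 1)) : ℝ) : EReal) := by
  rw [decrease, if_neg hk, upperBound_eq, upperBound_eq, ← Finset.sum_sub_distrib,
    Finset.sum_eq_single k]
  · congr 1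
    simp
    ring
  · intro s _ hs
    have : (s : Fin K) ≠ k := fun h => hs (Subtype.ext h)
    simp [this]
  · simp

theorem continuous_armVariance (k : {k // k ∈ R}) :
    Continuous fun P => armVariance g R P k := by
  unfold armVariance
  have := fun z => continuous_outProb (g := g) (R := R) ⟨k, z⟩
  fun_prop

/-- With at least two outcomes of positive probability, each probability is below one; the weights
are positive since `A⁺` has no zero column. -/
theorem armVariance_pos {P : Fin n → ℝ} (hP : P ∈ stdSimplex ℝ (Fin n)) {k : {k // k ∈ R}}
    [Nontrivial (Set.range (g k))] (hpos : ∀ z, 0 < outProb g R P ⟨k, z⟩) :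
    0 < armVariance g R P k := by
  have hlt : ∀ z, outProb g R P ⟨k, z⟩ < 1 := by
    intro z
    obtain ⟨z', hz'⟩ := exists_ne z
    rw [← hP.2, ← sum_outProb P k]
    exact Finset.single_lt_sum (f := fun z => outProb g R P ⟨k, z⟩) hz' (Finset.mem_univ _) (Finset.mem_univ _) (hpos z')
      fun _ _ _ => (hpos _).le
  obtain ⟨z⟩ : Nonempty (Set.range (g k)) := inferInstance
  refine Finset.sum_pos (fun z _ => mul_pos ?_ (mul_pos (hpos z) (sub_pos.2 (hlt z)))) ⟨z, by simp⟩
  obtain ⟨j, hj⟩ := exists_pinv_stackedMatrix_ne_zero (g := g) (R := R) ⟨k, z⟩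
  exact Finset.sum_pos' (fun _ _ => sq_nonneg _) ⟨j, Finset.mem_univ _, sq_pos_of_ne_zero hj⟩

end Decrease

/-! ### The dynamics along one sample path. -/

section Run

variable {n K : ℕ} {g : Fin K → Fin n → ℝ} {R : Finset (Fin K)}

theorem exists_isNextArm (hR : R.Nonempty) (P : Fin n → ℝ) (t : Fin K → ℕ)
    (σ : Equiv.Perm (Fin K)) : ∃ k, IsNextArm g R P t σ k := by
  classical
  obtain ⟨k, hk, hmax⟩ := R.exists_max_image (decrease g R P t) hR
  have hne : (bestArms g R P t).Nonempty := ⟨k, by simpa [bestArms] using ⟨hk, hmax⟩⟩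
  obtain ⟨s, hs, hmin⟩ := (bestArms g R P t).exists_min_image σ hne
  exact ⟨s, hs, hmin⟩

theorem IsNextArm.mem {P : Fin n → ℝ} {t : Fin K → ℕ} {σ : Equiv.Perm (Fin K)} {k : Fin K}
    (h : IsNextArm g R P t σ k) : k ∈ R := by
  classical
  exact (Finset.mem_filter.1 h.1).1

theorem IsNextArm.decrease_le {P : Fin n → ℝ} {t : Fin K → ℕ} {σ : Equiv.Perm (Fin K)}
    {k s : Fin K} (h : IsNextArm g R P t σ k) (hs : s ∈ R) :
    decrease g R P t s ≤ decrease g R P t k := by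
  classical
  exact (Finset.mem_filter.1 h.1).2 s hs

variable {π : ℕ → Equiv.Perm (Fin K)} {x : ℕ → Fin n}

/-- Arm `k` is pulled in the step from time `t` to time `t + 1`. -/
def IsPulled (g : Fin K → Fin n → ℝ) (π : ℕ → Equiv.Perm (Fin K)) (x : ℕ → Fin n) (t : ℕ)
    (k : Fin K) : Prop :=
  IsNextArm g (keptArms g (π 0)) (run g π x t).est (run g π x t).pulls (π (t + 1)) k

open Classical in
theorem pulls_succ (t : ℕ) (k : Fin K) : (run g π x (t + 1)).pulls k =
    (run g π x t).pulls k + if IsPulled g π x t k then 1 else 0 := rfl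

open Classical in
theorem counts_succ (t : ℕ) (k : Fin K) (z : ℝ) : (run g π x (t + 1)).counts k z =
    (run g π x t).counts k z + if IsPulled g π x t k ∧ g k (x t) = z then 1 else 0 := rfl

theorem est_succ (t : ℕ) : (run g π x (t + 1)).est =
    smoothedMLE g (keptArms g (π 0)) (run g π x (t + 1)).counts := rfl

theorem counts_le_pulls (t : ℕ) (k : Fin K) (z : ℝ) :
    (run g π x t).counts k z ≤ (run g π x t).pulls k := by
  classical
  induction t with
  | zero => exact le_rfl
  | succ t ih =>
    rw [pulls_succ, counts_succ]
    gcongr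
    split_ifs with h1 h2 <;> simp_all

theorem pulls_mono (k : Fin K) : Monotone fun t => (run g π x t).pulls k :=
  monotone_nat_of_le_succ fun t => by rw [pulls_succ]; exact Nat.le_add_right _ _

theorem le_sum_pulls (hR : (keptArms g (π 0)).Nonempty) (t : ℕ) :
    t ≤ ∑ k ∈ keptArms g (π 0), (run g π x t).pulls k := by
  classical
  induction t with
  | zero => exact Nat.zero_le _
  | succ t ih =>
    obtain ⟨k, hk⟩ := exists_isNextArm (g := g) hR (run g π x t).est (run g π x t).pulls (π (t + 1))
    simp_rw [pulls_succ]
    rw [Finset.sum_add_distrib]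
    refine add_le_add ih ?_
    calc 1 = if IsPulled g π x t k then 1 else 0 := (if_pos hk).symm
      _ ≤ _ := Finset.single_le_sum (f := fun k => if IsPulled g π x t k then 1 else 0)
        (fun _ _ => Nat.zero_le _) hk.mem

theorem tendsto_pulls_or_le (k : Fin K) :
    Tendsto (fun t => (run g π x t).pulls k) atTop atTop ∨
      ∃ B, ∀ t, (run g π x t).pulls k ≤ B := by
  by_cases h : ∃ B, ∀ t, (run g π x t).pulls k ≤ B
  · exact Or.inr h
  · push Not at h
    exact Or.inl (tendsto_atTop_atTop_of_monotone (pulls_mono k) fun b => (h b).imp fun t => le_of_lt)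

theorem exists_tendsto_pulls (hR : (keptArms g (π 0)).Nonempty) :
    ∃ k ∈ keptArms g (π 0), Tendsto (fun t => (run g π x t).pulls k) atTop atTop := by
  by_contra! h
  have h2 : ∀ k, ∃ B, k ∈ keptArms g (π 0) → ∀ t, (run g π x t).pulls k ≤ B := fun k => by
    by_cases hk : k ∈ keptArms g (π 0)
    · exact ((tendsto_pulls_or_le k).resolve_left (h k hk)).imp fun B hB _ => hB
    · exact ⟨0, fun h => absurd h hk⟩
  choose B hB using h2
  have h3 := le_sum_pulls (x := x) hR (∑ k ∈ keptArms g (π 0), B k + 1)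
  have h4 := Finset.sum_le_sum fun k hk => hB k hk (∑ k ∈ keptArms g (π 0), B k + 1)
  omega

theorem frequently_isPulled {k : Fin K}
    (h : Tendsto (fun t => (run g π x t).pulls k) atTop atTop) :
    ∃ᶠ t in atTop, IsPulled g π x t k := by
  classical
  intro hev
  obtain ⟨t₀, ht₀⟩ := eventually_atTop.1 hev
  have hconst : ∀ t, t₀ ≤ t → (run g π x t).pulls k = (run g π x t₀).pulls k := by
    intro t ht
    induction t, ht using Nat.le_induction with
    | base => rfl
    | succ t ht ih => rw [pulls_succ, ih, if_neg (ht₀ t ht), add_zero]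
  obtain ⟨t, ht, ht2⟩ := ((h.eventually_gt_atTop ((run g π x t₀).pulls k)).and
    (eventually_ge_atTop t₀)).exists
  exact ht.ne' (hconst t ht2)

variable {p : Fin n → ℝ}

theorem isSmoothedMLE_run (hp : ∀ j, 0 < p j) (hp1 : ∑ j, p j = 1) {t : ℕ} (ht : 0 < t) :
    IsSmoothedMLE g (keptArms g (π 0)) (run g π x t).counts (run g π x t).est := by
  obtain ⟨t, rfl⟩ := Nat.exists_eq_succ_of_ne_zero ht.ne'
  rw [Nat.succ_eq_add_one, est_succ]
  exact isSmoothedMLE_smoothedMLE _ hp hp1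

theorem est_mem_stdSimplex (hp : ∀ j, 0 < p j) (hp1 : ∑ j, p j = 1) (t : ℕ) :
    (run g π x t).est ∈ stdSimplex ℝ (Fin n) := by
  rcases Nat.eq_zero_or_pos t with rfl | ht
  · have hn : (n : ℝ) ≠ 0 := by
      rintro h
      rw [Nat.cast_eq_zero] at h
      subst h
      simp at hp1
    refine ⟨fun j => ?_, ?_⟩
    · simp [run, initState]
    · simp [run, initState, hn]
  · exact (isSmoothedMLE_run hp hp1 ht).1.1

/-- The observed frequencies of the arms that are pulled infinitely often converge to the outcome
probabilities. -/
def FrequenciesConverge (g : Fin K → Fin n → ℝ) (p : Fin n → ℝ) (π : ℕ → Equiv.Perm (Fin K))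
    (x : ℕ → Fin n) : Prop :=
  ∀ h : Row g (keptArms g (π 0)), Tendsto (fun t => (run g π x t).pulls h.1) atTop atTop →
    Tendsto (fun t => ((run g π x t).counts h.1 h.2 : ℝ) / (run g π x t).pulls h.1) atTop
      (𝓝 (outProb g (keptArms g (π 0)) p h))

/-- Each kept arm either is pulled infinitely often, and then `P'` matches `p` on it, or has bounded
counts; this is the dichotomy that the positivity lemma needs. -/
theorem exists_limit_est (hp : ∀ j, 0 < p j) (hp1 : ∑ j, p j = 1)
    (hfreq : FrequenciesConverge g p π x) {U : Ultrafilter ℕ} (hU : (U : Filter ℕ) ≤ atTop) :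
    ∃ P' ∈ stdSimplex ℝ (Fin n), Tendsto (fun t => (run g π x t).est) U (𝓝 P') ∧
      (∀ h, 0 < outProb g (keptArms g (π 0)) P' h) ∧
      ∀ h : Row g (keptArms g (π 0)), Tendsto (fun t => (run g π x t).pulls h.1) atTop atTop →
        outProb g (keptArms g (π 0)) P' h = outProb g (keptArms g (π 0)) p h := by
  obtain ⟨P', hP's, hP'⟩ := (isCompact_stdSimplex ℝ (Fin n)).ultrafilter_le_nhds
    (U.map fun t => (run g π x t).est) (le_principal_iff.2 <| Ultrafilter.mem_map.2 <|
      Filter.univ_mem' fun t => est_mem_stdSimplex hp hp1 t)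
  have hlim : Tendsto (fun t => (run g π x t).est) U (𝓝 P') := hP'
  have hmle : ∀ᶠ t in U, IsSmoothedMLE g (keptArms g (π 0)) (run g π x t).counts
      (run g π x t).est :=
    hU ((eventually_gt_atTop 0).mono fun t ht => isSmoothedMLE_run hp hp1 ht)
  have heq : ∀ h : Row g (keptArms g (π 0)),
      Tendsto (fun t => (run g π x t).pulls h.1) atTop atTop →
      outProb g (keptArms g (π 0)) P' h = outProb g (keptArms g (π 0)) p h := by
    intro h hh
    refine outProb_eq_of_tendsto (U := U) (T := fun t => (run g π x t).pulls) hp hp1 hmle hlim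
      (fun t k z => counts_le_pulls t k z) (fun k => ?_) (fun r hr => ?_) h (hh.mono_left hU)
    · exact (tendsto_pulls_or_le (k : Fin K)).imp (fun h => h.mono_left hU)
        fun ⟨B, hB⟩ => ⟨B, Eventually.of_forall hB⟩
    · refine (hfreq r ?_).mono_left hU
      rcases tendsto_pulls_or_le (g := g) (π := π) (x := x) (r.1 : Fin K) with h | ⟨B, hB⟩
      · exact h
      · obtain ⟨t, ht⟩ := (hr.eventually_gt_atTop B).exists
        exact absurd (hB t) ht.not_ge
  refine ⟨P', hP's, hlim, ?_, heq⟩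
  have hB : ∀ h : Row g (keptArms g (π 0)), ∃ B : ℝ,
      outProb g (keptArms g (π 0)) P' h = outProb g (keptArms g (π 0)) p h ∨
        ∀ᶠ t in U, ((run g π x t).counts h.1 h.2 : ℝ) ≤ B := fun h => by
    rcases tendsto_pulls_or_le (g := g) (π := π) (x := x) (h.1 : Fin K) with hh | ⟨B, hB⟩
    · exact ⟨0, Or.inl (heq h hh)⟩
    · exact ⟨B, Or.inr (Eventually.of_forall fun t => by
        exact_mod_cast (counts_le_pulls t _ _).trans (hB t))⟩
  choose B hB using hB
  exact outProb_pos_of_tendsto hp hp1 hmle hlim hB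

/-- If `k` had bounded pulls, then at the infinitely many times when some other arm `s` is pulled,
the decrease offered by `k` would be at most that of `s`, which tends to zero. -/
theorem tendsto_pulls (hp : ∀ j, 0 < p j) (hp1 : ∑ j, p j = 1)
    (hfreq : FrequenciesConverge g p π x) {k : Fin K} (hk : k ∈ keptArms g (π 0)) :
    Tendsto (fun t => (run g π x t).pulls k) atTop atTop := by
  refine (tendsto_pulls_or_le k).resolve_right ?_
  rintro ⟨B, hB⟩
  obtain ⟨s, hs, hsT⟩ := exists_tendsto_pulls (g := g) (π := π) (x := x) ⟨k, hk⟩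
  have hks : k ≠ s := by
    rintro rfl
    obtain ⟨t, ht⟩ := (hsT.eventually_gt_atTop B).exists
    exact (hB t).not_gt ht
  have := nontrivial_range_of_mem_keptArms hk hs hks
  -- The ultrafilter is concentrated on times at which `s` is pulled, so that the greedy rule
  -- compares `k` with `s` there.
  obtain ⟨U, hU, hUs⟩ : ∃ U : Ultrafilter ℕ, (U : Filter ℕ) ≤ atTop ∧
      ∀ᶠ t in U, IsPulled g π x t s := by
    have := frequently_iff_neBot.1 (frequently_isPulled hsT)
    exact ⟨Ultrafilter.of _, (Ultrafilter.of_le _).trans inf_le_left,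
      (Ultrafilter.of_le _).trans inf_le_right (mem_principal_self _)⟩
  obtain ⟨P', hP's, hlim, hpos, -⟩ := exists_limit_est hp hp1 hfreq hU
  have hkv : 0 < armVariance g (keptArms g (π 0)) P' ⟨k, hk⟩ := armVariance_pos hP's fun z => hpos _
  have hklim := ((continuous_armVariance (g := g) ⟨k, hk⟩).tendsto P').comp hlim
  have hslim := ((continuous_armVariance (g := g) ⟨s, hs⟩).tendsto P').comp hlim
  have hsTr : Tendsto (fun t => ((run g π x t).pulls s : ℝ)) U atTop :=
    tendsto_natCast_atTop_atTop.comp (hsT.mono_left hU)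
  have hδ : Tendsto (fun t => 1 / ((run g π x t).pulls s : ℝ) - 1 / (((run g π x t).pulls s : ℝ) + 1))
      U (𝓝 0) := by
    simpa using (hsTr.const_div_atTop 1).sub ((hsTr.atTop_add tendsto_const_nhds).const_div_atTop 1)
  -- A lower bound for `1 / (t * (t + 1))` with `0 < t ≤ B`.
  have hlim2 := hklim.mul_const (1 / (((B : ℝ) + 1) * (B + 1)))
  have hcmp := le_of_tendsto_of_tendsto hlim2 (hslim.mul hδ) ?_
  · rw [mul_zero] at hcmp
    have : 0 < armVariance g (keptArms g (π 0)) P' ⟨k, hk⟩ * (1 / (((B : ℝ) + 1) * (B + 1))) := by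
      positivity
    linarith
  · filter_upwards [hUs, hU (hsT.eventually_gt_atTop 0), hklim.eventually_const_lt hkv]
      with t ht hs0 hkpos
    have hle := ht.decrease_le hk
    -- An unpulled `k` would offer an infinite decrease, whereas that of `s` is finite.
    have hk0 : (run g π x t).pulls k ≠ 0 := by
      intro h0
      rw [decrease, if_pos h0, top_le_iff, decrease, if_neg hs0.ne'] at hle
      exact EReal.coe_ne_top _ hle
    rw [decrease_eq ⟨k, hk⟩ hk0, decrease_eq ⟨s, hs⟩ hs0.ne', EReal.coe_le_coe_iff] at hle
    refine le_trans ?_ hle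
    refine mul_le_mul_of_nonneg_left ?_ hkpos.le
    have h1 : (0 : ℝ) < (run g π x t).pulls k := by exact_mod_cast Nat.pos_of_ne_zero hk0
    have h2 : ((run g π x t).pulls k : ℝ) ≤ B := by exact_mod_cast hB t
    rw [div_sub_div _ _ h1.ne' (by positivity)]
    have h3 : (1 : ℝ) * (((run g π x t).pulls k : ℝ) + 1) - (run g π x t).pulls k * 1 = 1 := by ring
    simp only [h3]
    gcongr
    linarith

theorem tendsto_est (hA : (stackedMatrix g Finset.univ).rank = n) (hp : ∀ j, 0 < p j)
    (hp1 : ∑ j, p j = 1) (hfreq : FrequenciesConverge g p π x) :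
    Tendsto (fun t => (run g π x t).est) atTop (𝓝 p) := by
  rw [tendsto_iff_ultrafilter]
  intro U hU
  obtain ⟨P', -, hlim, -, heq⟩ := exists_limit_est hp hp1 hfreq hU
  have : P' = p := eq_of_outProb_keptArms_eq hA fun r =>
    heq r (tendsto_pulls hp hp1 hfreq r.1.2)
  exact this ▸ hlim

end Run

end ArmSampling

namespace ArmSampling

section Randomness

variable {n K : ℕ} {g : Fin K → Fin n → ℝ}

/-! ### The dependence of the algorithm on its random inputs -/

/-- The algorithm is nonanticipating; measurability and adaptedness are derived from this. -/
theorem run_congr {π π' : ℕ → Equiv.Perm (Fin K)} {x x' : ℕ → Fin n} {t : ℕ}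
    (hπ : ∀ s ≤ t, π s = π' s) (hx : ∀ s < t, x s = x' s) : run g π x t = run g π' x' t := by
  induction t with
  | zero => rfl
  | succ t ih =>
    rw [run, run, ih (fun s hs => hπ s (hs.trans t.le_succ)) (fun s hs => hx s (hs.trans t.lt_succ_self)),
      hπ 0 (Nat.zero_le _), hπ (t + 1) le_rfl, hx t t.lt_succ_self]

theorem isPulled_congr {π π' : ℕ → Equiv.Perm (Fin K)} {x x' : ℕ → Fin n} {t : ℕ}
    (hπ : ∀ s ≤ t + 1, π s = π' s) (hx : ∀ s < t, x s = x' s) (k : Fin K) :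
    IsPulled g π x t k ↔ IsPulled g π' x' t k := by
  rw [IsPulled, IsPulled, run_congr (fun s hs => hπ s (hs.trans t.le_succ)) hx,
    hπ 0 (Nat.zero_le _), hπ (t + 1) le_rfl]

variable {Ω : Type*} {mΩ : MeasurableSpace Ω} {μ : Measure Ω}

/-- Every subset of a discrete space is measurable, so dependence on finitely many finite-valued
inputs suffices, and nothing need be known about the maximizer chosen as estimate. -/
theorem measurable_of_factorsThrough {α β : Type*} [MeasurableSpace α] [DiscreteMeasurableSpace α]
    [MeasurableSpace β] {Φ : Ω → α} (hΦ : Measurable Φ) {F : Ω → β}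
    (hF : Function.FactorsThrough F Φ) : Measurable F := by
  intro s _
  have : F ⁻¹' s = Φ ⁻¹' (Φ '' (F ⁻¹' s)) := by
    refine (Set.subset_preimage_image _ _).antisymm ?_
    rintro ω ⟨ω', hω', h⟩
    rwa [Set.mem_preimage, ← hF h]
  rw [this]
  exact hΦ (MeasurableSet.of_discrete)

theorem indepFun_prodMk_of_prodMk_indepFun [IsFiniteMeasure μ] {α β γ : Type*} [MeasurableSpace α]
    [MeasurableSpace β] [MeasurableSpace γ] {f : Ω → α} {f' : Ω → β} {f'' : Ω → γ}
    (hf : Measurable f) (hf' : Measurable f') (hf'' : Measurable f'')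
    (h : IndepFun f f' μ) (h' : IndepFun (fun ω => (f ω, f' ω)) f'' μ) :
    IndepFun f (fun ω => (f' ω, f'' ω)) μ := by
  have h'' : IndepFun f' f'' μ := h'.comp (φ := Prod.snd) (ψ := id) measurable_snd measurable_id
  rw [indepFun_iff_map_prod_eq_prod_map_map hf.aemeasurable (hf'.prodMk hf'').aemeasurable,
    (indepFun_iff_map_prod_eq_prod_map_map hf'.aemeasurable hf''.aemeasurable).1 h'',
    ← Measure.prodAssoc_prod,
    ← (indepFun_iff_map_prod_eq_prod_map_map hf.aemeasurable hf'.aemeasurable).1 h,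
    ← (indepFun_iff_map_prod_eq_prod_map_map (hf.prodMk hf').aemeasurable hf''.aemeasurable).1 h',
    Measure.map_map (MeasurableEquiv.measurable _) ((hf.prodMk hf').prodMk hf'')]
  rfl

/-- The realizations before time `t`, together with all the random orders on the arms. -/
def history (X : ℕ → Ω → Fin n) (π : ℕ → Ω → Equiv.Perm (Fin K)) (t : ℕ) (ω : Ω) :
    (Finset.range t → Fin n) × (ℕ → Fin K → Fin K) :=
  (fun s => X s ω, fun s k => π s ω k)

variable {X : ℕ → Ω → Fin n} {π : ℕ → Ω → Equiv.Perm (Fin K)}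

theorem measurable_orders (hπ : ∀ t k, Measurable fun ω => π t ω k) :
    Measurable fun ω t k => π t ω k :=
  measurable_pi_lambda _ fun t => measurable_pi_lambda _ fun k => hπ t k

theorem measurable_history (hX : ∀ t, Measurable (X t))
    (hπ : ∀ t k, Measurable fun ω => π t ω k) (t : ℕ) : Measurable (history X π t) := by
  have h : Measurable fun ω (s : Finset.range t) => X s ω := measurable_pi_lambda _ fun s => hX s
  exact h.prodMk (measurable_orders hπ)

/-- The filtration generated by the histories. -/
def historyFiltration (hX : ∀ t, Measurable (X t)) (hπ : ∀ t k, Measurable fun ω => π t ω k) :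
    Filtration ℕ mΩ where
  seq t := MeasurableSpace.comap (history X π t) inferInstance
  mono' t u htu := by
    have h : history X π t = (fun q => (fun s : Finset.range t => q.1 ⟨s, Finset.range_mono htu s.2⟩, q.2))
      ∘ history X π u := rfl
    change MeasurableSpace.comap (history X π t) _ ≤ _
    rw [h, ← MeasurableSpace.comap_comp]
    exact MeasurableSpace.comap_mono (Measurable.comap_le (by fun_prop))
  le' t := (measurable_history hX hπ t).comap_le

/-- `X t` is independent of the earlier realizations, and all realizations jointly are independent
of the orders. The orders may have any joint law, so they are put into every history, future ones
included. -/
theorem indepFun_history [IsProbabilityMeasure μ] (hX : ∀ t, Measurable (X t))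
    (hindep : iIndepFun X μ) (hπ : ∀ t k, Measurable fun ω => π t ω k)
    (hXπ : IndepFun (fun ω t => X t ω) (fun ω t k => π t ω k) μ) (t : ℕ) :
    IndepFun (X t) (history X π t) μ := by
  refine indepFun_prodMk_of_prodMk_indepFun (hX t) (measurable_pi_lambda _ fun s => hX s)
    (measurable_orders hπ) ?_ ?_
  · have h := hindep.indepFun_finset {t} (Finset.range t) (by simp) hX
    exact h.comp (φ := fun q : ({t} : Finset ℕ) → Fin n => q ⟨t, by simp⟩) (ψ := id)
      (measurable_pi_apply _) measurable_id
  · exact hXπ.comp (φ := fun q => (q t, fun s : Finset.range t => q s)) (ψ := id)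
      (by fun_prop) measurable_id

/-- Only realizations before `t` must be measurable, and the σ-algebra on `Ω` is arbitrary: the
lemma serves both for the full one and for that of a history. -/
theorem measurable_of_forall_eq (hπ : ∀ t k, Measurable fun ω => π t ω k) {t u : ℕ}
    (hX : ∀ s < t, Measurable (X s)) {β : Type*} [MeasurableSpace β] {F : Ω → β}
    (hF : ∀ ω ω', (∀ s < t, X s ω = X s ω') → (∀ s ≤ u, π s ω = π s ω') → F ω = F ω') :
    Measurable F := by
  refine measurable_of_factorsThrough (α := (Finset.range t → Fin n) × (Fin (u + 1) → Fin K → Fin K))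
    (Φ := fun ω => (fun s : Finset.range t => X s ω, fun s k => π s ω k)) ?_ ?_
  · have h : Measurable fun ω (s : Finset.range t) => X s ω :=
      measurable_pi_lambda _ fun s => hX s (Finset.mem_range.1 s.2)
    exact h.prodMk (measurable_pi_lambda _ fun s => measurable_pi_lambda _ fun k => hπ s k)
  · intro ω ω' h
    rw [Prod.mk.injEq] at h
    refine hF ω ω' (fun s hs => congrFun h.1 ⟨s, Finset.mem_range.2 hs⟩) fun s hs => ?_
    exact Equiv.ext fun k => congrFun (congrFun h.2 ⟨s, Nat.lt_succ_of_le hs⟩) k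

theorem measurable_history_orders (t s : ℕ) (k : Fin K) :
    Measurable[MeasurableSpace.comap (history X π t) inferInstance] fun ω => π s ω k := by
  have h : (fun ω => π s ω k) = (fun q => q.2 s k) ∘ history X π t := rfl
  rw [h]
  exact Measurable.comp (by fun_prop) (comap_measurable _)

theorem measurable_history_realization {t s : ℕ} (hs : s < t) :
    Measurable[MeasurableSpace.comap (history X π t) inferInstance] (X s) := by
  have h : X s = (fun q => q.1 ⟨s, Finset.mem_range.2 hs⟩) ∘ history X π t := rfl
  rw [h]
  exact Measurable.comp (by fun_prop) (comap_measurable _)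

theorem integral_comp_eq_sum [IsProbabilityMeasure μ] {p : Fin n → ℝ} {Y : Ω → Fin n}
    (hY : Measurable Y) (hlaw : ∀ j, μ.real {ω | Y ω = j} = p j) (f : Fin n → ℝ) :
    ∫ ω, f (Y ω) ∂μ = ∑ j, p j * f j := by
  rw [← integral_map hY.aemeasurable (f := f) (measurable_of_finite f).aestronglyMeasurable,
    integral_fintype (Integrable.of_finite)]
  refine Finset.sum_congr rfl fun j _ => ?_
  rw [map_measureReal_apply hY (measurableSet_singleton j), ← hlaw j]
  rfl

open Classical in
theorem pulls_eq_sum (σ : ℕ → Equiv.Perm (Fin K)) (x : ℕ → Fin n) (k : Fin K) (t : ℕ) :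
    ((run g σ x t).pulls k : ℝ) = ∑ s ∈ Finset.range t, if IsPulled g σ x s k then 1 else 0 := by
  induction t with
  | zero => simp [run, initState]
  | succ t ih => rw [Finset.sum_range_succ, pulls_succ, ← ih]; push_cast; rfl

open Classical in
theorem counts_sub_eq_sum (σ : ℕ → Equiv.Perm (Fin K)) (x : ℕ → Fin n) (k : Fin K) (z q : ℝ)
    (t : ℕ) : ((run g σ x t).counts k z : ℝ) - q * (run g σ x t).pulls k =
      ∑ s ∈ Finset.range t, (if IsPulled g σ x s k then 1 else 0) *
        ((if g k (x s) = z then 1 else 0) - q) := by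
  induction t with
  | zero => simp [run, initState]
  | succ t ih =>
    rw [Finset.sum_range_succ, pulls_succ, counts_succ, ← ih]
    by_cases h1 : IsPulled g σ x t k <;> by_cases h2 : g k (x t) = z <;> simp [h1, h2] <;> ring

/-- The strong law of large numbers for the outcomes of an adaptively pulled arm. -/
theorem ae_tendsto_counts_div_pulls [IsProbabilityMeasure μ] {p : Fin n → ℝ}
    (hp : ∀ j, 0 < p j) (hp1 : ∑ j, p j = 1) (hX : ∀ t, Measurable (X t))
    (hlaw : ∀ t j, μ.real {ω | X t ω = j} = p j) (hindep : iIndepFun X μ)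
    (hπ : ∀ t k, Measurable fun ω => π t ω k)
    (hXπ : IndepFun (fun ω t => X t ω) (fun ω t k => π t ω k) μ) (k : Fin K) (z : ℝ) :
    ∀ᵐ ω ∂μ, Tendsto (fun t => (run g (fun s => π s ω) (fun s => X s ω) t).pulls k) atTop atTop →
      Tendsto (fun t => ((run g (fun s => π s ω) (fun s => X s ω) t).counts k z : ℝ) /
        (run g (fun s => π s ω) (fun s => X s ω) t).pulls k) atTop
        (𝓝 (∑ j, if g k j = z then p j else 0)) := by
  classical
  set q : ℝ := ∑ j, if g k j = z then p j else 0 with hq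
  have hq0 : 0 ≤ q := Finset.sum_nonneg fun j _ => by split_ifs <;> simp [(hp j).le]
  have hq1 : q ≤ 1 := by
    rw [← hp1]
    exact Finset.sum_le_sum fun j _ => by split_ifs <;> simp [(hp j).le]
  set ℱ := historyFiltration hX hπ
  set f : Fin n → ℝ := fun j => (if g k j = z then 1 else 0) - q with hf
  have hfm : Measurable f := measurable_of_finite f
  have hslln := ae_tendsto_sum_mul_div_sum (μ := μ) (ℱ := ℱ)
    (a := fun t ω => if IsPulled g (fun s => π s ω) (fun s => X s ω) t k then (1 : ℝ) else 0)
    (ξ := fun t ω => f (X t ω)) ?_ ?_ ?_ ?_ ?_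
  · filter_upwards [hslln] with ω hω hT
    have hTr := tendsto_natCast_atTop_atTop (R := ℝ).comp hT
    have h1 := hω (hTr.congr fun t => pulls_eq_sum _ _ k t)
    simp_rw [← pulls_eq_sum, hf, ← counts_sub_eq_sum] at h1
    have h2 := h1.add_const q
    rw [zero_add] at h2
    refine h2.congr' ?_
    filter_upwards [hTr.eventually_gt_atTop 0] with t ht
    have : ((run g (fun s => π s ω) (fun s => X s ω) t).pulls k : ℝ) ≠ 0 := ne_of_gt ht
    field_simp
    ring
  · intro t
    -- The pull that observes `X t` uses the order `π (t + 1)`, hence `u := t + 1`; the history at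
    -- time `t` already contains it.
    refine Measurable.stronglyMeasurable (measurable_of_forall_eq (X := X) (π := π) (t := t)
      (u := t + 1) (mΩ := ℱ t) (fun s k => measurable_history_orders t s k)
      (fun s hs => measurable_history_realization hs) fun ω ω' hx hσ => ?_)
    simp_rw [isPulled_congr (g := g) (fun s hs => hσ s hs) (fun s hs => hx s hs) k]
  · intro t ω
    split_ifs <;> simp
  · intro t
    exact (hfm.comp (measurable_history_realization t.lt_succ_self)).stronglyMeasurable
  · intro t ω
    simp only [abs_le, hf]
    split_ifs <;> constructor <;> linarith
  · intro t
    have hmean : ∫ ω, f (X t ω) ∂μ = 0 := by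
      rw [integral_comp_eq_sum (hX t) (hlaw t)]
      simp [hf, mul_sub, ← Finset.sum_mul, hp1, hq]
    have hi : Indep (MeasurableSpace.comap (X t) inferInstance) (ℱ t) μ :=
      indepFun_history hX hindep hπ hXπ t
    have := condExp_indep_eq (f := fun ω => f (X t ω)) (hX t).comap_le (ℱ.le t)
      (hfm.comp (comap_measurable (X t))).stronglyMeasurable hi
    rw [hmean] at this
    exact this

theorem ae_frequenciesConverge [IsProbabilityMeasure μ] {p : Fin n → ℝ}
    (hp : ∀ j, 0 < p j) (hp1 : ∑ j, p j = 1) (hX : ∀ t, Measurable (X t))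
    (hlaw : ∀ t j, μ.real {ω | X t ω = j} = p j) (hindep : iIndepFun X μ)
    (hπ : ∀ t k, Measurable fun ω => π t ω k)
    (hXπ : IndepFun (fun ω t => X t ω) (fun ω t k => π t ω k) μ) :
    ∀ᵐ ω ∂μ, FrequenciesConverge g p (fun s => π s ω) (fun s => X s ω) := by
  have h := ae_all_iff.2 fun k : Fin K => ae_all_iff.2 fun i : Fin n =>
    ae_tendsto_counts_div_pulls (g := g) hp hp1 hX hlaw hindep hπ hXπ k (g k i)
  filter_upwards [h] with ω hω
  rintro ⟨k, z, i, rfl⟩ hT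
  rw [outProb_eq]
  exact hω k i hT

end Randomness

end ArmSampling

/-! ### From sample paths to the mean squared error. -/

theorem theorem7 {n K : ℕ} (g : Fin K → Fin n → ℝ)
    (hA : (ArmSampling.stackedMatrix g Finset.univ).rank = n)
    (p : Fin n → ℝ) (hp : ∀ j, 0 < p j) (hp1 : ∑ j, p j = 1)
    {Ω : Type*} [MeasurableSpace Ω] (μ : Measure Ω) [IsProbabilityMeasure μ]
    (X : ℕ → Ω → Fin n) (hX : ∀ t, Measurable (X t))
    (hlaw : ∀ t j, μ.real {ω | X t ω = j} = p j)
    (hindep : iIndepFun X μ)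
    (π : ℕ → Ω → Equiv.Perm (Fin K)) (hπ : ∀ t k, Measurable fun ω => π t ω k)
    (hXπ : IndepFun (fun ω t => X t ω) (fun ω t k => π t ω k) μ) :
    (∀ᵐ ω ∂μ,
      (∀ k ∈ ArmSampling.keptArms g (π 0 ω),
        Tendsto (fun t => (ArmSampling.run g (fun s => π s ω) (fun s => X s ω) t).pulls k)
          atTop atTop) ∧
      (∀ r, ¬ ArmSampling.Redundant g r →
        ∃ k ∈ ArmSampling.keptArms g (π 0 ω),
          ArmSampling.rowSpace (g k) = ArmSampling.rowSpace (g r))) ∧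
    (∀ t, Integrable (fun ω =>
      ∑ j, ((ArmSampling.run g (fun s => π s ω) (fun s => X s ω) t).est j - p j) ^ 2) μ) ∧
    Tendsto (fun t => ∫ ω,
      ∑ j, ((ArmSampling.run g (fun s => π s ω) (fun s => X s ω) t).est j - p j) ^ 2 ∂μ)
      atTop (𝓝 0) := by
  have hfreq := ArmSampling.ae_frequenciesConverge (g := g) hp hp1 hX hlaw hindep hπ hXπ
  have hmeas : ∀ t, AEStronglyMeasurable (fun ω =>
      ∑ j, ((ArmSampling.run g (fun s => π s ω) (fun s => X s ω) t).est j - p j) ^ 2) μ := fun t =>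
    (ArmSampling.measurable_of_forall_eq (t := t) (u := t) hπ (fun s _ => hX s)
      fun ω ω' hx hσ => by
        rw [ArmSampling.run_congr (π := fun s => π s ω) (x := fun s => X s ω) hσ hx]
      ).aestronglyMeasurable
  -- Both distributions have coordinates in `[0, 1]`, so each squared difference is at most one;
  -- this gives the dominating constant.
  have hbound : ∀ t ω, ‖∑ j, ((ArmSampling.run g (fun s => π s ω) (fun s => X s ω) t).est j
      - p j) ^ 2‖ ≤ n := by
    intro t ω
    have hle : ∀ {P : Fin n → ℝ}, P ∈ stdSimplex ℝ (Fin n) → ∀ j, P j ≤ 1 := fun hP j =>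
      hP.2 ▸ Finset.single_le_sum (fun i _ => hP.1 i) (Finset.mem_univ j)
    have hest := ArmSampling.est_mem_stdSimplex (g := g) (π := fun s => π s ω)
      (x := fun s => X s ω) hp hp1 t
    rw [Real.norm_of_nonneg (Finset.sum_nonneg fun j _ => sq_nonneg _)]
    refine (Finset.sum_le_card_nsmul Finset.univ _ 1 fun j _ => ?_).trans (by simp)
    rw [sq_le_one_iff_abs_le_one, abs_le]
    have h1 := hest.1 j
    have h2 := hle hest j
    have h3 := hle ⟨fun j => (hp j).le, hp1⟩ j
    have h4 := (hp j).le
    constructor <;> linarith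
  refine ⟨?_, fun t => Integrable.of_bound (hmeas t) n (ae_of_all _ (hbound t)), ?_⟩
  · filter_upwards [hfreq] with ω hω
    exact ⟨fun k hk => ArmSampling.tendsto_pulls (π := fun s => π s ω) hp hp1 hω hk,
      fun r hr => ArmSampling.exists_mem_keptArms_rowSpace_eq hr⟩
  · have hlim := tendsto_integral_of_dominated_convergence (fun _ => (n : ℝ)) hmeas
      (integrable_const _) (fun t => ae_of_all _ (hbound t)) (f := fun _ => 0) ?_
    · simpa using hlim
    · filter_upwards [hfreq] with ω hω
      have h := ArmSampling.tendsto_est (π := fun s => π s ω) hA hp hp1 hω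
      have h2 := tendsto_finsetSum Finset.univ fun j _ =>
        ((tendsto_pi_nhds.1 h j).sub_const (p j)).pow 2
      simpa using h2
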